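/- Let $n,d,r,t\ge 1$ and $s\ge 0$ be integers, and write $[n]=\{1,\dots,n\}$. **Codes.** For integers $q\ge 2$ and $k\ge 1$, a quantum code $\mathcal C$ with parameters $[n,k,d]$ is a subspace $\mathcal C\subseteq(\mathbb C^q)^{\otimes n}$ of dimension $q^k$ with distance at least $d$: for every operator $E$ acting on fewer than $d$ of the $n$ qudits there is $c\in\mathbb C$ with $\langle\varphi|E|\psi\rangle=c\langle\varphi|\psi\rangle$ for all $\varphi,\psi\in\mathcal C$. The code is an *exact $(r,t,s)$-qLRC* if there are sets $\Gamma_l(j)\subseteq[n]$ ($1\le l\le t$, $1\le j\le n$) such that for every $j$ 1. $j\in\Gamma_l(j)$ and $|\Gamma_l(j)|=r+1$ for all $l$; 2. $|\Gamma_{l_1}(j)\cap\Gamma_{l_2}(j)|=s+1$ for all $l_1\ne l_2$; 3. $\Gamma_{l_1}(j)\cap\Gamma_{l_2}(j)\cap\Gamma_{l_3}(j)=\{j\}$ for all pairwise distinct $l_1,l_2,l_3$; 4. for every $l$ there is a quantum channel (completely positive trace-preserving map) $\mathrm{Rec}_{l,j}$ from the qudits in $\Gamma_l(j)\setminus\{j\}$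 to the qudits in $\Gamma_l(j)$, acting as the identity on all qudits outside $\Gamma_l(j)$, with $\mathrm{Rec}_{l,j}(\mathrm{Tr}_j|\psi\rangle\langle\psi|)=|\psi\rangle\langle\psi|$ for every unit vector $\psi\in\mathcal C$. **Quantities.** Put $$N_e(r,L,s)=\frac{2r-(L-1)s}{2}\,L+1,\qquad p_e=p_e(r,t,s)=\sum_{L=1}^{t}(-1)^{L+1}\binom tL\frac1{N_e(r,L,s)}.$$ For integers $m$ and $M\ge 0$ let $N_1(m,r,d,M)=0$ if $m<\max\{r+1,d-1\}$, and otherwise $$N_1(m,r,d,M)=\max\Big\{N\in\mathbb Z:\ 0\le N\le M,\ N(r+1)-\frac{N(N-1)}{M(M-1)}\big(M(r+1)-m\big)\le m-(d-1)\Big\},$$ where the fraction $\frac{N(N-1)}{M(M-1)}$ is read as $0$ when $M\le 1$. Let $$M_1=(d-1)+N_1\big(n,r,d,\lceil n p_e\rceil\big),\qquad M_2=(d-1)+N_1\big(n-M_1,r,d,\lceil (n-M_1)p_e\rceil\big),$$ where $M_2=d-1$ if $n<M_1$. **Theorem.** (a) For all $q\ge2$ and $k\ge1$, if $\mathcal C\subseteq(\mathbb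 C^q)^{\otimes n}$ is an exact $(r,t,s)$-qLRC with parameters $[n,k,d]$, then $$k\le\max\{0,\;n-M_1-M_2\}.$$ (b) This bound is at least as strong as the Golowich–Guruswami bound: whenever $r\ge s(t-1)$ (which holds for the parameters of every exact $(r,t,s)$-qLRC), $$n-M_1-M_2\;\le\; n-2(d-1)-\Big\lfloor\frac{n-(d-1)}{r+1}\Big\rfloor-\left\lfloor\frac{n-2(d-1)-\big\lfloor\frac{n-(d-1)}{r+1}\big\rfloor}{r+1}\right\rfloor .$$ -/

import Mathlib

namespace QLRC

open scoped Matrix ComplexOrder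

noncomputable section

/-! ### Quantum channels -/

/-- `Φ ⊗ id`, acting on matrices over a composite system whose second factor is left untouched. -/
def ampliation {α β γ : Type} (Φ : Matrix α α ℂ →ₗ[ℂ] Matrix β β ℂ)
    (X : Matrix (α × γ) (α × γ) ℂ) : Matrix (β × γ) (β × γ) ℂ :=
  Matrix.of fun x y => Φ (Matrix.of fun a b => X (a, x.2) (b, y.2)) x.1 y.1

/-- A quantum channel: a linear map that is trace preserving and completely positive. -/
def IsQuantumChannel {α β : Type} [Fintype α] [Fintype β]
    (Φ : Matrix α α ℂ →ₗ[ℂ] Matrix β β ℂ) : Prop :=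
  (∀ X, (Φ X).trace = X.trace) ∧
    ∀ (m : ℕ) (X : Matrix (α × Fin m) (α × Fin m) ℂ),
      X.PosSemidef → (ampliation Φ X).PosSemidef

/-! ### Systems of `n` qudits of dimension `q`

The space `(ℂ^q)^{⊗ n}` is the space of functions on the `q ^ n` computational basis labels
`Fin n → Fin q`. -/

/-- State vectors of `n` qudits. -/
abbrev Vec (n q : ℕ) : Type := (Fin n → Fin q) → ℂ

/-- Operators on the qudits with labels in `ι`. -/
abbrev Op (ι : Type) (q : ℕ) : Type := Matrix (ι → Fin q) (ι → Fin q) ℂ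

/-- The rank-one operator `|ψ⟩⟨ψ|`. -/
def proj {n q : ℕ} (ψ : Vec n q) : Op (Fin n) q := Matrix.vecMulVec ψ (star ψ)

/-- The partial trace over qudit `j`, an operator on the remaining qudits. -/
def partialTrace {n q : ℕ} (j : Fin n) (ρ : Op (Fin n) q) : Op {i : Fin n // i ≠ j} q :=
  Matrix.of fun u v => ∑ c : Fin q,
    ρ (fun i => if h : i = j then c else u ⟨i, h⟩) (fun i => if h : i = j then c else v ⟨i, h⟩)

/-- A linear map `Φ` from the operators on the qudits `S \ {j}` to the operators on the qudits `S`,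
tensored with the identity on all qudits outside `S`: it takes an operator on the `n - 1` qudits
other than `j` to an operator on all `n` qudits. -/
def applyOn {n q : ℕ} (j : Fin n) (S : Finset (Fin n))
    (Φ : Op {i // i ∈ S.erase j} q →ₗ[ℂ] Op {i // i ∈ S} q)
    (σ : Op {i : Fin n // i ≠ j} q) : Op (Fin n) q :=
  Matrix.of fun x y =>
    Φ (Matrix.of fun a b =>
        σ (fun i => if h : i.1 ∈ S.erase j then a ⟨i.1, h⟩ else x i.1)
          (fun i => if h : i.1 ∈ S.erase j then b ⟨i.1, h⟩ else y i.1))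
      (fun i => x i.1) (fun i => y i.1)

/-- `E` acts only on the qudits in `S`: it is `A ⊗ id` for some operator `A` on those qudits. -/
def SupportedOn {n q : ℕ} (S : Finset (Fin n)) (E : Op (Fin n) q) : Prop :=
  ∃ A : Op {i // i ∈ S} q, ∀ x y,
    E x y = if ∀ i ∉ S, x i = y i then A (fun i => x i.1) (fun i => y i.1) else 0

/-! ### Quantum codes -/

/-- A quantum code on `n` qudits is a subspace of `(ℂ^q)^{⊗ n}`. -/
abbrev Code (n q : ℕ) : Type := Submodule ℂ (Vec n q)

/-- The code has distance at least `d`: every error `E` acting on fewer than `d` qudits is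
detectable, that is `P E P = c P` for some scalar `c`, `P` the projection onto the code. -/
def DistanceAtLeast {n q : ℕ} (C : Code n q) (d : ℕ) : Prop :=
  ∀ (S : Finset (Fin n)) (E : Op (Fin n) q), S.card < d → SupportedOn S E →
    ∃ c : ℂ, ∀ φ ∈ C, ∀ ψ ∈ C, star φ ⬝ᵥ (E *ᵥ ψ) = c * (star φ ⬝ᵥ ψ)

/-- An `[n, k, d]` code: it encodes `k` logical qudits and has distance at least `d`. -/
def HasParameters {n q : ℕ} (C : Code n q) (k d : ℕ) : Prop :=
  Module.finrank ℂ C = q ^ k ∧ DistanceAtLeast C d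

/-! ### Exact locally recoverable codes -/

/-- The exact `(r, t, s)`-condition on a family `Γ l j`, `l ∈ [t]`, `j ∈ [n]`. -/
structure ExactCondition {n t : ℕ} (r s : ℕ) (Γ : Fin t → Fin n → Finset (Fin n)) : Prop where
  card_eq : ∀ l j, (Γ l j).card = r + 1
  mem : ∀ l j, j ∈ Γ l j
  card_inter : ∀ j l₁ l₂, l₁ ≠ l₂ → (Γ l₁ j ∩ Γ l₂ j).card = s + 1
  triple_inter : ∀ j l₁ l₂ l₃, l₁ ≠ l₂ → l₁ ≠ l₃ → l₂ ≠ l₃ →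
    Γ l₁ j ∩ Γ l₂ j ∩ Γ l₃ j = {j}

/-- `S` is a recovery set of qudit `j`: some quantum channel that reads only the qudits in
`S \ {j}` and writes only the qudits in `S` restores every code state after the erasure of `j`. -/
def IsRecoverySet {n q : ℕ} (C : Code n q) (j : Fin n) (S : Finset (Fin n)) : Prop :=
  ∃ Rec : Op {i // i ∈ S.erase j} q →ₗ[ℂ] Op {i // i ∈ S} q,
    IsQuantumChannel Rec ∧
      ∀ ψ ∈ C, star ψ ⬝ᵥ ψ = 1 → applyOn j S Rec (partialTrace j (proj ψ)) = proj ψ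

/-- An exact `(r, t, s)`-qLRC. -/
def IsExactQLRC {n q : ℕ} (C : Code n q) (r t s : ℕ) : Prop :=
  ∃ Γ : Fin t → Fin n → Finset (Fin n),
    ExactCondition r s Γ ∧ ∀ l j, IsRecoverySet C j (Γ l j)

/-! ### The quantities in the bound -/

/-- `N_e(r, L, s) = (2r - (L-1)s)/2 · L + 1`. -/
def Ne (r L s : ℕ) : ℚ := (2 * (r : ℚ) - ((L : ℚ) - 1) * s) / 2 * L + 1

/-- `p_e(r, t, s) = ∑_{1 ≤ L ≤ t} (-1)^{L+1} C(t, L) / N_e(r, L, s)`. -/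
def pe (r t s : ℕ) : ℚ :=
  ∑ L ∈ Finset.Icc 1 t, (-1 : ℚ) ^ (L + 1) * (t.choose L : ℚ) * (1 / Ne r L s)

/-- `N_1(n, r, d, M)`. In the first branch the set contains `0` and is bounded by `M`, so that its
supremum is its maximum. The fraction is read as `0` when `M ≤ 1` (its numerator is then `0`). -/
def N₁ (n r d M : ℕ) : ℕ :=
  if max (r + 1) (d - 1) ≤ n then
    sSup {N : ℕ | N ≤ M ∧
      (N : ℚ) * (r + 1)
          - ((N : ℚ) * ((N : ℚ) - 1)) / ((M : ℚ) * ((M : ℚ) - 1)) * ((M : ℚ) * (r + 1) - n)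
        ≤ (n : ℚ) - ((d : ℚ) - 1)}
  else 0

/-- `M_1 = (d-1) + N_1(n, r, d, ⌈n p_e⌉)`. -/
def M₁ (n d r t s : ℕ) : ℕ := (d - 1) + N₁ n r d ⌈(n : ℚ) * pe r t s⌉₊

/-- `M_2 = (d-1) + N_1(n - M_1, r, d, ⌈(n - M_1) p_e⌉)`. If `n < M_1`, the truncated difference is
`0`, and `N_1` vanishes at `0` as it does at negative arguments. -/
def M₂ (n d r t s : ℕ) : ℕ :=
  (d - 1) + N₁ (n - M₁ n d r t s) r d ⌈((n - M₁ n d r t s : ℕ) : ℚ) * pe r t s⌉₊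

/-- The Golowich–Guruswami bound
`n - 2(d-1) - ⌊(n-(d-1))/(r+1)⌋ - ⌊(n - 2(d-1) - ⌊(n-(d-1))/(r+1)⌋)/(r+1)⌋`. -/
def ggBound (n d r : ℕ) : ℤ :=
  (n : ℤ) - 2 * ((d : ℤ) - 1) - ⌊((n : ℚ) - ((d : ℚ) - 1)) / ((r : ℚ) + 1)⌋
    - ⌊((n : ℚ) - 2 * ((d : ℚ) - 1) - (⌊((n : ℚ) - ((d : ℚ) - 1)) / ((r : ℚ) + 1)⌋ : ℤ))
        / ((r : ℚ) + 1)⌋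

end

end QLRC

namespace QLRC

open scoped Matrix ComplexOrder

/-- A family of mutually orthogonal copies of a system of vectors with a common Gram matrix spans
a space whose dimension is the number of copies times the rank of the system. -/
theorem card_mul_finrank_span_le {K α X : Type} [Fintype K] [DecidableEq K] [Fintype X]
    (v : K → α → X → ℂ) (ρ : α → α → ℂ)
    (hv : ∀ i j a a', star (v i a) ⬝ᵥ v j a' = if i = j then ρ a a' else 0)
    (S : Submodule ℂ (X → ℂ)) (hS : ∀ i a, v i a ∈ S) (i₀ : K) :
    Fintype.card K * Module.finrank ℂ (Submodule.span ℂ (Set.range (v i₀)))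
      ≤ Module.finrank ℂ S := by
  obtain ⟨f, hf, -, hli⟩ :=
    Submodule.exists_fun_fin_finrank_span_eq ℂ (Set.range (v i₀))
  generalize Module.finrank ℂ (Submodule.span ℂ (Set.range (v i₀))) = N at f hf hli ⊢
  choose a ha using hf
  have hli' : LinearIndependent ℂ
      (fun p : K × Fin N =>
        (⟨v p.1 (a p.2), hS _ _⟩ : S)) := by
    rw [Fintype.linearIndependent_iff]
    intro g hg
    have hg' : ∑ p : K × Fin N,
        g p • v p.1 (a p.2) = 0 := by
      have := congrArg (Subtype.val) hg
      simpa using this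
    have key : ∀ j, ∑ s, g (j, s) • v i₀ (a s) = 0 := by
      intro j
      have h1 : ∀ s', star (v i₀ (a s')) ⬝ᵥ (∑ s, g (j, s) • v i₀ (a s)) = 0 := by
        intro s'
        have h2 := congrArg (fun w => star (v j (a s')) ⬝ᵥ w) hg'
        simp only [dotProduct_sum, dotProduct_smul, hv, dotProduct_zero, Fintype.sum_prod_type] at h2
        rw [Finset.sum_eq_single j] at h2
        · simpa only [dotProduct_sum, dotProduct_smul, hv, if_true] using h2
        · intro b _ hb
          simp [Ne.symm hb]
        · simp
      have h3 : star (∑ s, g (j, s) • v i₀ (a s)) ⬝ᵥ (∑ s, g (j, s) • v i₀ (a s)) = 0 := by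
        conv_lhs => rw [star_sum, sum_dotProduct]
        refine Finset.sum_eq_zero fun s' _ => ?_
        rw [star_smul, smul_dotProduct, h1, smul_zero]
      exact dotProduct_star_self_eq_zero.1 h3
    intro ⟨j, s⟩
    have h4 := key j
    simp only [ha] at h4
    exact Fintype.linearIndependent_iff.1 hli (fun s => g (j, s)) h4 s
  simpa using hli'.fintype_card_le_finrank

/-- Matrices with a common Gram matrix `M Mᴴ` have a common column space. -/
theorem range_mulVecLin_self_mul_conjTranspose {m p : Type} [Fintype m] [Fintype p]
    (M : Matrix m p ℂ) :
    LinearMap.range (M * Mᴴ).mulVecLin = LinearMap.range M.mulVecLin := by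
  classical
  refine Submodule.eq_of_le_of_finrank_eq ?_ (Matrix.rank_self_mul_conjTranspose M)
  rw [Matrix.mulVecLin_mul]
  exact LinearMap.range_comp_le_range _ _

/-- The functions on `β × γ` all of whose sections lie in `U`. -/
def sectionsIn {β : Type} (γ : Type) (U : Submodule ℂ (β → ℂ)) : Submodule ℂ (β × γ → ℂ) where
  carrier := {f | ∀ c, (fun b => f (b, c)) ∈ U}
  add_mem' hf hg c := U.add_mem (hf c) (hg c)
  zero_mem' _ := U.zero_mem
  smul_mem' z _ hf c := U.smul_mem z (hf c)

theorem finrank_sectionsIn_le {β γ : Type} [Fintype β] [Fintype γ] (U : Submodule ℂ (β → ℂ)) :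
    Module.finrank ℂ (sectionsIn γ U) ≤ Fintype.card γ * Module.finrank ℂ U := by
  let F : sectionsIn γ U →ₗ[ℂ] (γ → U) :=
    { toFun := fun f c => ⟨fun b => f.1 (b, c), f.2 c⟩
      map_add' := fun _ _ => rfl
      map_smul' := fun _ _ => rfl }
  have hF : Function.Injective F := by
    intro f g h
    ext ⟨b, c⟩
    exact congrFun (congrArg Subtype.val (congrFun h c)) b
  simpa [Module.finrank_pi_fintype] using LinearMap.finrank_le_finrank_of_injective hF

/-- One half of the no-cloning bound: the rank inequality for two correctable subsystems. -/
theorem card_mul_finrank_le_of_gram {K α β γ : Type} [Fintype K] [DecidableEq K]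
    [Fintype α] [Fintype β] [Fintype γ] (Ψ : K → α → β → γ → ℂ)
    (ρA : α → α → ℂ) (ρB : β → β → ℂ)
    (hA : ∀ i j a a', ∑ b, ∑ c, star (Ψ i a b c) * Ψ j a' b c = if i = j then ρA a a' else 0)
    (hB : ∀ i j b b', ∑ a, ∑ c, star (Ψ i a b c) * Ψ j a b' c = if i = j then ρB b b' else 0)
    (i₀ : K) :
    Fintype.card K *
        Module.finrank ℂ (Submodule.span ℂ (Set.range fun a (x : β × γ) => Ψ i₀ a x.1 x.2))
      ≤ Fintype.card γ *
        Module.finrank ℂ (Submodule.span ℂ (Set.range fun b (x : α × γ) => Ψ i₀ x.1 b x.2)) := by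
  let M : K → Matrix β (α × γ) ℂ := fun i => Matrix.of fun b x => Ψ i x.1 b x.2
  have hM : ∀ i, M i * (M i)ᴴ = Matrix.of fun b b' => ρB b' b := by
    intro i
    ext b b'
    have := hB i i b' b
    simp only [if_true] at this
    rw [Matrix.of_apply, ← this, Matrix.mul_apply, Fintype.sum_prod_type]
    simp [M, mul_comm]
  have hU : ∀ i, LinearMap.range (M i).mulVecLin = LinearMap.range (M i₀).mulVecLin := fun i => by
    rw [← range_mulVecLin_self_mul_conjTranspose, ← range_mulVecLin_self_mul_conjTranspose (M i₀),
      hM, hM]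
  have h1 := card_mul_finrank_span_le (fun i a (x : β × γ) => Ψ i a x.1 x.2) ρA
    (fun i j a a' => by
      rw [← hA i j a a']
      simp [dotProduct, Fintype.sum_prod_type])
    (sectionsIn γ (LinearMap.range (M i₀).mulVecLin))
    (fun i a c => by
      classical
      rw [← hU i]
      exact ⟨Pi.single (a, c) 1, by ext b; simp [M]⟩) i₀
  have h2 : Module.finrank ℂ (LinearMap.range (M i₀).mulVecLin) =
      Module.finrank ℂ (Submodule.span ℂ (Set.range fun b (x : α × γ) => Ψ i₀ x.1 b x.2)) :=
    Matrix.rank_eq_finrank_span_row (M i₀)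
  rw [← h2]
  exact h1.trans (finrank_sectionsIn_le _)

/-- A family of vectors of a tripartite system from which neither of the first two subsystems
learns anything has at most as many members as the third subsystem has dimensions. -/
theorem card_le_card_of_gram {K α β γ : Type} [Fintype K] [DecidableEq K]
    [Fintype α] [Fintype β] [Fintype γ] (Ψ : K → α → β → γ → ℂ)
    (ρA : α → α → ℂ) (ρB : β → β → ℂ)
    (hA : ∀ i j a a', ∑ b, ∑ c, star (Ψ i a b c) * Ψ j a' b c = if i = j then ρA a a' else 0)
    (hB : ∀ i j b b', ∑ a, ∑ c, star (Ψ i a b c) * Ψ j a b' c = if i = j then ρB b b' else 0)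
    (hΨ : ∀ i, Ψ i ≠ 0) : Fintype.card K ≤ Fintype.card γ := by
  rcases isEmpty_or_nonempty K with hK | ⟨⟨i₀⟩⟩
  · simp
  have h1 := card_mul_finrank_le_of_gram Ψ ρA ρB hA hB i₀
  have h2 := card_mul_finrank_le_of_gram (fun i b a c => Ψ i a b c) ρB ρA hB hA i₀
  set rA := Module.finrank ℂ (Submodule.span ℂ (Set.range fun a (x : β × γ) => Ψ i₀ a x.1 x.2))
  set rB := Module.finrank ℂ (Submodule.span ℂ (Set.range fun b (x : α × γ) => Ψ i₀ x.1 b x.2))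
  have hpos : 0 < rA := by
    rw [Nat.pos_iff_ne_zero]
    intro h0
    have h3 := Submodule.finrank_eq_zero.1 h0
    rw [Submodule.span_eq_bot] at h3
    refine hΨ i₀ ?_
    ext a b c
    exact congrFun (h3 _ ⟨a, rfl⟩) (b, c)
  by_contra! hlt
  have h5 : Fintype.card γ * (Fintype.card γ * rA) < Fintype.card K * (Fintype.card K * rA) := by
    have := Nat.mul_lt_mul'' hlt hlt
    rw [← mul_assoc, ← mul_assoc]
    exact Nat.mul_lt_mul_of_pos_right this hpos
  have h6 : Fintype.card K * (Fintype.card K * rA) ≤ Fintype.card K * (Fintype.card γ * rB) :=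
    Nat.mul_le_mul_left _ h1
  have h7 : Fintype.card γ * (Fintype.card K * rB) ≤ Fintype.card γ * (Fintype.card γ * rA) :=
    Nat.mul_le_mul_left _ h2
  have h8 : Fintype.card K * (Fintype.card γ * rB) = Fintype.card γ * (Fintype.card K * rB) := by
    ring
  omega

end QLRC

namespace QLRC

open scoped Matrix ComplexOrder

variable {n q : ℕ}

/-- The operator `|a⟩⟨a'|` on the qudits in `A`, tensored with the identity elsewhere. -/
def matrixUnit (A : Finset (Fin n)) (a a' : Fin n → Fin q) : Op (Fin n) q :=
  Matrix.of fun x y => if (∀ i ∈ A, x i = a i ∧ y i = a' i) ∧ ∀ i ∉ A, x i = y i then 1 else 0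

/-- The Knill–Laflamme condition for the erasure of the qudits in `A`. -/
def Correctable (C : Code n q) (A : Finset (Fin n)) : Prop :=
  ∀ a a' : Fin n → Fin q, ∃ c : ℂ, ∀ φ ∈ C, ∀ ψ ∈ C,
    star φ ⬝ᵥ (matrixUnit A a a' *ᵥ ψ) = c * (star φ ⬝ᵥ ψ)

theorem matrixUnit_mulVec (A : Finset (Fin n)) (a a' : Fin n → Fin q) (v : Vec n q)
    (x : Fin n → Fin q) :
    (matrixUnit A a a' *ᵥ v) x = if ∀ i ∈ A, x i = a i then v (A.piecewise a' x) else 0 := by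
  have h : ∀ y, ((∀ i ∈ A, x i = a i ∧ y i = a' i) ∧ ∀ i ∉ A, x i = y i) ↔
      (∀ i ∈ A, x i = a i) ∧ y = A.piecewise a' x := by
    intro y
    constructor
    · rintro ⟨h1, h2⟩
      refine ⟨fun i hi => (h1 i hi).1, funext fun i => ?_⟩
      by_cases hi : i ∈ A
      · simp [hi, (h1 i hi).2]
      · simp [hi, h2 i hi]
    · rintro ⟨h1, rfl⟩
      exact ⟨fun i hi => ⟨h1 i hi, by simp [hi]⟩, fun i hi => by simp [hi]⟩
  rw [Matrix.mulVec, dotProduct, Finset.sum_eq_single (A.piecewise a' x)]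
  · simp only [matrixUnit, Matrix.of_apply, h, and_true, ite_mul, one_mul, zero_mul]
  · intro y _ hy
    simp only [matrixUnit, Matrix.of_apply, h, hy, and_false, if_false, zero_mul]
  · simp

theorem supportedOn_matrixUnit (A : Finset (Fin n)) (a a' : Fin n → Fin q) :
    SupportedOn A (matrixUnit A a a') := by
  refine ⟨Matrix.of fun u v => if ∀ i : {i // i ∈ A}, u i = a i ∧ v i = a' i then 1 else 0,
    fun x y => ?_⟩
  simp only [matrixUnit, Matrix.of_apply, Subtype.forall]
  split_ifs <;> first | rfl | tauto

theorem DistanceAtLeast.correctable {C : Code n q} {d : ℕ} (h : DistanceAtLeast C d)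
    {A : Finset (Fin n)} (hA : A.card < d) : Correctable C A := fun a a' =>
  h A _ hA (supportedOn_matrixUnit A a a')

/-- An orthonormal basis of a code. -/
theorem exists_orthonormal (C : Code n q) :
    ∃ v : Fin (Module.finrank ℂ C) → Vec n q, (∀ i, v i ∈ C) ∧
      ∀ i j, star (v i) ⬝ᵥ v j = if i = j then 1 else 0 := by
  let e := (WithLp.linearEquiv 2 ℂ (Vec n q)).symm
  let C' : Submodule ℂ (EuclideanSpace ℂ (Fin n → Fin q)) := C.map e.toLinearMap
  have hfin : Module.finrank ℂ C' = Module.finrank ℂ C := LinearEquiv.finrank_map_eq e C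
  let b := (stdOrthonormalBasis ℂ C').reindex (finCongr hfin)
  refine ⟨fun i => WithLp.ofLp (b i : EuclideanSpace ℂ (Fin n → Fin q)), fun i => ?_,
    fun i j => ?_⟩
  · obtain ⟨w, hw, hwe⟩ := (b i).2
    have h : WithLp.ofLp (b i : EuclideanSpace ℂ (Fin n → Fin q)) = w := by rw [← hwe]; rfl
    simp only [h]
    exact hw
  · have := orthonormal_iff_ite.1 b.orthonormal i j
    rw [← this, Submodule.coe_inner, EuclideanSpace.inner_eq_star_dotProduct, dotProduct_comm]

/-- Splitting the labels of `n` qudits into those in `A`, those in `B` and the others. -/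
def splitEquiv (q : ℕ) {A B : Finset (Fin n)} (hAB : Disjoint A B) :
    ({i // i ∈ A} → Fin q) × ({i // i ∈ B} → Fin q) × ({i // i ∈ (A ∪ B)ᶜ} → Fin q) ≃
      (Fin n → Fin q) where
  toFun p i := if hA : i ∈ A then p.1 ⟨i, hA⟩ else if hB : i ∈ B then p.2.1 ⟨i, hB⟩
    else p.2.2 ⟨i, by simp [hA, hB]⟩
  invFun x := (fun i => x i, fun i => x i, fun i => x i)
  left_inv p := by
    refine Prod.ext (funext fun i => ?_) (Prod.ext (funext fun i => ?_) (funext fun i => ?_))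
    · simp [i.2]
    · simp [i.2, Finset.disjoint_right.1 hAB i.2]
    · have := i.2
      simp only [Finset.mem_compl, Finset.mem_union, not_or] at this
      simp [this.1, this.2]
  right_inv x := by
    ext i
    dsimp only
    split_ifs <;> rfl

theorem sum_star_mul_eq_of_left {A B : Finset (Fin n)} (hAB : Disjoint A B) (φ ψ : Vec n q)
    (a a' : Fin n → Fin q) :
    ∑ b, ∑ c, star (φ (splitEquiv q hAB (fun i => a i, b, c))) *
        ψ (splitEquiv q hAB (fun i => a' i, b, c)) =
      star φ ⬝ᵥ (matrixUnit A a a' *ᵥ ψ) := by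
  rw [dotProduct, ← (splitEquiv q hAB).sum_comp, Fintype.sum_prod_type,
    Finset.sum_eq_single (fun i : {i // i ∈ A} => a i), Fintype.sum_prod_type]
  · refine Finset.sum_congr rfl fun b _ => Finset.sum_congr rfl fun c _ => ?_
    rw [matrixUnit_mulVec, if_pos, Pi.star_apply]
    · congr 2
      ext i
      by_cases hi : i ∈ A <;> simp [hi, splitEquiv]
    · intro i hi
      simp [hi, splitEquiv]
  · intro a₁ _ ha₁
    refine Finset.sum_eq_zero fun p _ => ?_
    rw [matrixUnit_mulVec, if_neg, mul_zero]
    intro h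
    refine ha₁ (funext fun i => ?_)
    simpa [splitEquiv] using h i i.2
  · simp

theorem sum_star_mul_eq_of_right {A B : Finset (Fin n)} (hAB : Disjoint A B) (φ ψ : Vec n q)
    (b b' : Fin n → Fin q) :
    ∑ a, ∑ c, star (φ (splitEquiv q hAB (a, fun i => b i, c))) *
        ψ (splitEquiv q hAB (a, fun i => b' i, c)) =
      star φ ⬝ᵥ (matrixUnit B b b' *ᵥ ψ) := by
  rw [dotProduct, ← (splitEquiv q hAB).sum_comp, Fintype.sum_prod_type]
  refine Finset.sum_congr rfl fun a _ => ?_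
  rw [Fintype.sum_prod_type, Finset.sum_eq_single (fun i : {i // i ∈ B} => b i)]
  · refine Finset.sum_congr rfl fun c _ => ?_
    rw [matrixUnit_mulVec, if_pos, Pi.star_apply]
    · congr 2
      ext i
      by_cases hi : i ∈ B
      · simp [hi, splitEquiv, Finset.disjoint_right.1 hAB hi]
      · simp [hi, splitEquiv]
    · intro i hi
      simp [hi, splitEquiv, Finset.disjoint_right.1 hAB hi]
  · intro b₁ _ hb₁
    refine Finset.sum_eq_zero fun p _ => ?_
    rw [matrixUnit_mulVec, if_neg, mul_zero]
    intro h
    refine hb₁ (funext fun i => ?_)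
    simpa [splitEquiv, Finset.disjoint_right.1 hAB i.2] using h i i.2
  · simp

/-- If the erasures of two disjoint sets of qudits are correctable, then the dimension of the code
is at most that of the system formed by the other qudits. -/
theorem Correctable.finrank_le [NeZero q] {C : Code n q} {A B : Finset (Fin n)}
    (hA : Correctable C A) (hB : Correctable C B) (hAB : Disjoint A B) :
    Module.finrank ℂ C ≤ q ^ (n - A.card - B.card) := by
  obtain ⟨v, hvC, hv⟩ := exists_orthonormal C
  choose ρA hρA using hA
  choose ρB hρB using hB
  have hext : ∀ (D : Finset (Fin n)) (a : {i // i ∈ D} → Fin q), ∃ x : Fin n → Fin q,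
      a = fun i : {i // i ∈ D} => x i := fun D a =>
    ⟨fun i => if h : i ∈ D then a ⟨i, h⟩ else 0, funext fun i => by simp [i.2]⟩
  choose x hx using hext
  have := card_le_card_of_gram (fun i a b c => v i (splitEquiv q hAB (a, b, c)))
    (fun a a' => ρA (x A a) (x A a')) (fun b b' => ρB (x B b) (x B b'))
    (fun i j a a' => by
      have h := hρA (x A a) (x A a') _ (hvC i) _ (hvC j)
      rw [← sum_star_mul_eq_of_left hAB, ← hx, ← hx, hv] at h
      simpa using h)
    (fun i j b b' => by
      have h := hρB (x B b) (x B b') _ (hvC i) _ (hvC j)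
      rw [← sum_star_mul_eq_of_right hAB, ← hx, ← hx, hv] at h
      simpa using h)
    (fun i h => by
      have h0 : v i = 0 := by
        ext y
        obtain ⟨p, rfl⟩ := (splitEquiv q hAB).surjective y
        exact congrFun (congrFun (congrFun h p.1) p.2.1) p.2.2
      have h1 := hv i i
      rw [h0] at h1
      simp at h1)
  rw [Fintype.card_fin, Fintype.card_fun, Fintype.card_fin, Fintype.card_coe,
    Finset.card_compl, Finset.card_union_of_disjoint hAB, Fintype.card_fin, ← Nat.sub_sub] at this
  exact this

end QLRC

namespace QLRC

open scoped Matrix ComplexOrder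

variable {n q : ℕ}

/-- A quantum channel has a Kraus decomposition. -/
theorem IsQuantumChannel.exists_kraus {α β : Type} [Fintype α] [Fintype β] [DecidableEq α]
    {Φ : Matrix α α ℂ →ₗ[ℂ] Matrix β β ℂ} (hΦ : IsQuantumChannel Φ) :
    ∃ (κ : Type) (_ : Fintype κ) (K : κ → Matrix β α ℂ),
      (∀ X b b', Φ X b b' = ∑ m, ∑ a, ∑ a', K m b a * X a a' * star (K m b' a')) ∧
      ∀ a a', ∑ m, ∑ b, star (K m b a) * K m b a' = if a = a' then 1 else 0 := by
  classical
  let e := Fintype.equivFin α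
  let w : α × Fin (Fintype.card α) → ℂ := fun p => if e p.1 = p.2 then 1 else 0
  have hpsd := hΦ.2 _ _ (Matrix.posSemidef_vecMulVec_self_star w)
  obtain ⟨B, hB⟩ : ∃ B : Matrix (β × Fin (Fintype.card α)) (β × Fin (Fintype.card α)) ℂ,
      ampliation Φ (Matrix.vecMulVec w (star w)) = Bᴴ * B := by
    open scoped MatrixOrder in
    exact CStarAlgebra.nonneg_iff_eq_star_mul_self.mp hpsd.nonneg
  have hsingle : ∀ a a' b b', Φ (Matrix.single a a' 1) b b' =
      ∑ m, star (B m (b, e a)) * B m (b', e a') := by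
    intro a a' b b'
    have h1 := congrFun (congrFun hB (b, e a)) (b', e a')
    rw [Matrix.mul_apply] at h1
    simp only [Matrix.conjTranspose_apply] at h1
    rw [← h1]
    simp only [ampliation, Matrix.of_apply]
    refine congrFun (congrFun (?_ : Φ _ = Φ _) b) b'
    refine congrArg Φ (Matrix.ext fun u u' => ?_)
    simp only [w, Matrix.of_apply, Matrix.vecMulVec_apply, Pi.star_apply, Matrix.single_apply,
      EmbeddingLike.apply_eq_iff_eq]
    simp only [eq_comm (a := u), eq_comm (a := u')]
    by_cases hu : a = u <;> by_cases hu' : a' = u' <;> simp [hu, hu']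
  have hX : ∀ X b b', Φ X b b' =
      ∑ m, ∑ a, ∑ a', star (B m (b, e a)) * X a a' * star (star (B m (b', e a'))) := by
    intro X b b'
    have h1 : Φ X = ∑ a, ∑ a', X a a' • Φ (Matrix.single a a' 1) := by
      conv_lhs => rw [Matrix.matrix_eq_sum_single X]
      simp only [map_sum]
      refine Finset.sum_congr rfl fun a _ => Finset.sum_congr rfl fun a' _ => ?_
      rw [← map_smul, Matrix.smul_single, smul_eq_mul, mul_one]
    rw [h1, Finset.sum_comm]
    simp only [Matrix.sum_apply, Matrix.smul_apply, hsingle, smul_eq_mul, Finset.mul_sum, star_star]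
    rw [Finset.sum_comm]
    conv_rhs => rw [Finset.sum_comm]
    refine Finset.sum_congr rfl fun a _ => ?_
    rw [Finset.sum_comm]
    refine Finset.sum_congr rfl fun m _ => Finset.sum_congr rfl fun a' _ => ?_
    ring
  refine ⟨_, inferInstance, fun m => Matrix.of fun b a => star (B m (b, e a)), hX, fun a a' => ?_⟩
  have htr := hΦ.1 (Matrix.single a' a 1)
  simp only [Matrix.trace, Matrix.diag, hsingle] at htr
  simp only [Matrix.of_apply, star_star]
  rw [Finset.sum_comm]
  calc _ = _ := Finset.sum_congr rfl fun b _ => Finset.sum_congr rfl fun m _ => mul_comm _ _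
    _ = _ := htr
    _ = _ := by
      by_cases h : a = a'
      · subst h
        simp [Matrix.single_apply]
      · rw [if_neg h]
        exact Matrix.trace_single_eq_of_ne _ _ _ (Ne.symm h)

/-- The operator `K ⊗ ⟨c|` from all qudits to all qudits, where `⟨c|` acts on qudit `j` and `K` maps
the qudits in `S \ {j}` to the qudits in `S`. -/
def extendKraus (j : Fin n) (S : Finset (Fin n))
    (K : Matrix ({i // i ∈ S} → Fin q) ({i // i ∈ S.erase j} → Fin q) ℂ) (c : Fin q) :
    Op (Fin n) q :=
  Matrix.of fun x y =>
    if (∀ i ∉ S, x i = y i) ∧ y j = c then K (fun i => x i) (fun i => y i) else 0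

/-- The labels `x` with those in `S \ {j}` replaced by `a` and that of `j` replaced by `c`. -/
def relabel (j : Fin n) (S : Finset (Fin n)) (x : Fin n → Fin q)
    (a : {i // i ∈ S.erase j} → Fin q) (c : Fin q) : Fin n → Fin q :=
  fun i => if _ : i = j then c else if h : i ∈ S.erase j then a ⟨i, h⟩ else x i

theorem eq_relabel_iff {j : Fin n} {S : Finset (Fin n)} (hj : j ∈ S) (x y : Fin n → Fin q)
    (a : {i // i ∈ S.erase j} → Fin q) (c : Fin q) :
    y = relabel j S x a c ↔ ((∀ i ∉ S, x i = y i) ∧ y j = c) ∧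
      a = fun i : {i // i ∈ S.erase j} => y i := by
  constructor
  · rintro rfl
    refine ⟨⟨fun i hi => ?_, by simp [relabel]⟩, funext fun i => ?_⟩
    · have : i ≠ j := fun h => hi (h ▸ hj)
      simp [relabel, hi, this]
    · have := i.2
      rw [Finset.mem_erase] at this
      simp [relabel, this]
  · rintro ⟨⟨h1, h2⟩, rfl⟩
    ext i
    unfold relabel
    split_ifs with h3 h4
    · rw [h3, h2]
    · rfl
    · rw [h1 i fun h => h4 (Finset.mem_erase.2 ⟨h3, h⟩)]

theorem extendKraus_mulVec {j : Fin n} {S : Finset (Fin n)} (hj : j ∈ S)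
    (K : Matrix ({i // i ∈ S} → Fin q) ({i // i ∈ S.erase j} → Fin q) ℂ) (c : Fin q)
    (ψ : Vec n q) (x : Fin n → Fin q) :
    (extendKraus j S K c *ᵥ ψ) x = ∑ a, K (fun i => x i) a * ψ (relabel j S x a c) := by
  have h : ∀ y, extendKraus j S K c x y =
      ∑ a, K (fun i => x i) a * if y = relabel j S x a c then 1 else 0 := by
    intro y
    simp only [eq_relabel_iff hj]
    by_cases hy : (∀ i ∉ S, x i = y i) ∧ y j = c
    · simp only [extendKraus, Matrix.of_apply, if_pos hy]
      rw [Finset.sum_eq_single fun i : {i // i ∈ S.erase j} => y i]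
      · rw [if_pos ⟨hy, rfl⟩, mul_one]
      · intro a _ ha
        rw [if_neg fun h => ha h.2, mul_zero]
      · simp
    · simp only [extendKraus, Matrix.of_apply, if_neg hy]
      exact (Finset.sum_eq_zero fun a _ => by rw [if_neg fun h => hy h.1, mul_zero]).symm
  simp only [Matrix.mulVec, dotProduct, h, Finset.sum_mul]
  rw [Finset.sum_comm]
  simp

theorem applyOn_partialTrace_proj {j : Fin n} {S : Finset (Fin n)} (hj : j ∈ S)
    {Φ : Op {i // i ∈ S.erase j} q →ₗ[ℂ] Op {i // i ∈ S} q} {κ : Type} [Fintype κ]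
    (K : κ → Matrix ({i // i ∈ S} → Fin q) ({i // i ∈ S.erase j} → Fin q) ℂ)
    (hK : ∀ X b b', Φ X b b' = ∑ m, ∑ a, ∑ a', K m b a * X a a' * star (K m b' a'))
    (ψ : Vec n q) :
    applyOn j S Φ (partialTrace j (proj ψ)) =
      ∑ p : κ × Fin q, proj (extendKraus j S (K p.1) p.2 *ᵥ ψ) := by
  ext x y
  rw [Matrix.sum_apply, Fintype.sum_prod_type]
  simp only [applyOn, Matrix.of_apply, hK, partialTrace, proj, Matrix.vecMulVec_apply,
    Pi.star_apply, extendKraus_mulVec hj, star_sum, Finset.sum_mul_sum, star_mul']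
  refine Finset.sum_congr rfl fun m _ => ?_
  simp only [Finset.mul_sum, Finset.sum_mul]
  conv_rhs => rw [Finset.sum_comm]
  refine Finset.sum_congr rfl fun a _ => ?_
  conv_rhs => rw [Finset.sum_comm]
  refine Finset.sum_congr rfl fun b _ => Finset.sum_congr rfl fun c _ => ?_
  change _ * (ψ (relabel j S x a c) * star (ψ (relabel j S y b c))) * _ = _
  ring

/-- A vector all of whose dyads sum up to that of a unit vector `ψ` is a multiple of `ψ`. -/
theorem eq_smul_of_sum_proj_eq {ι : Type} [Fintype ι] (v : ι → Vec n q) {ψ : Vec n q}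
    (hψ : star ψ ⬝ᵥ ψ = 1) (h : ∑ m, proj (v m) = proj ψ) (m : ι) :
    v m = (star ψ ⬝ᵥ v m) • ψ := by
  have hproj : ∀ w u : Vec n q, star u ⬝ᵥ (proj w *ᵥ u) = star (star w ⬝ᵥ u) * (star w ⬝ᵥ u) := by
    intro w u
    rw [proj, Matrix.vecMulVec_mulVec, dotProduct_smul, ← Matrix.star_dotProduct]
    simp
  set u := v m - (star ψ ⬝ᵥ v m) • ψ with hu
  have h1 : star ψ ⬝ᵥ u = 0 := by
    rw [hu, dotProduct_sub, dotProduct_smul, hψ, smul_eq_mul, mul_one, sub_self]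
  have h2 : ∑ m, star (star (v m) ⬝ᵥ u) * (star (v m) ⬝ᵥ u) = 0 := by
    have := hproj ψ u
    rw [← h, h1, mul_zero, Matrix.sum_mulVec, dotProduct_sum] at this
    rw [← this]
    exact Finset.sum_congr rfl fun m _ => (hproj _ _).symm
  have h3 : star (v m) ⬝ᵥ u = 0 := by
    have := (Fintype.sum_eq_zero_iff_of_nonneg fun m => star_mul_self_nonneg _).1 h2
    simpa using congrFun this m
  have h4 : star u ⬝ᵥ u = 0 := by
    conv_lhs => rw [hu, star_sub, star_smul, sub_dotProduct, smul_dotProduct]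
    rw [← hu, h3, h1, smul_zero, sub_zero]
  exact sub_eq_zero.1 (dotProduct_star_self_eq_zero.1 h4)

/-- An operator that maps every vector of a subspace to a multiple of it is a scalar on it. -/
theorem exists_mulVec_eq_smul (C : Code n q) (T : Op (Fin n) q)
    (h : ∀ ψ ∈ C, star ψ ⬝ᵥ ψ = 1 → ∃ c : ℂ, T *ᵥ ψ = c • ψ) :
    ∃ c : ℂ, ∀ ψ ∈ C, T *ᵥ ψ = c • ψ := by
  have h' : ∀ ψ ∈ C, ∃ c : ℂ, T *ᵥ ψ = c • ψ := by
    intro ψ hψ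
    by_cases h0 : ψ = 0
    · exact ⟨0, by simp [h0]⟩
    obtain ⟨hre, him⟩ := Complex.pos_iff.1 (Matrix.dotProduct_star_self_pos_iff.2 h0)
    set r := (star ψ ⬝ᵥ ψ).re with hr
    have hr' : star ψ ⬝ᵥ ψ = (r : ℂ) := Complex.ext rfl (by simpa using him.symm)
    set z : ℂ := (((Real.sqrt r)⁻¹ : ℝ) : ℂ) with hz
    have hz0 : z ≠ 0 := by
      rw [hz, Complex.ofReal_ne_zero]
      exact inv_ne_zero (Real.sqrt_pos.2 hre).ne'
    obtain ⟨c, hc⟩ := h (z • ψ) (C.smul_mem z hψ) (by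
      rw [star_smul, smul_dotProduct, dotProduct_smul, hr', hz, smul_eq_mul, smul_eq_mul,
        Complex.star_def, Complex.conj_ofReal, ← Complex.ofReal_mul, ← Complex.ofReal_mul,
        ← mul_assoc, ← mul_inv, Real.mul_self_sqrt hre.le, inv_mul_cancel₀ hre.ne',
        Complex.ofReal_one])
    refine ⟨c, ?_⟩
    rw [Matrix.mulVec_smul, smul_comm] at hc
    exact smul_right_injective _ hz0 hc
  have hT : ∀ ψ ∈ C, Matrix.toLin' T ψ ∈ C := fun ψ hψ => by
    obtain ⟨c, hc⟩ := h' ψ hψ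
    rw [Matrix.toLin'_apply, hc]
    exact C.smul_mem c hψ
  obtain ⟨c, hc⟩ := LinearMap.exists_eq_smul_id_of_forall_notLinearIndependent
    (f := (Matrix.toLin' T).restrict hT) (fun ψ => by
      obtain ⟨c, hc⟩ := h' ψ ψ.2
      rw [LinearIndependent.pair_iff]
      push Not
      refine ⟨c, -1, ?_, by simp⟩
      ext1
      simp [hc])
  refine ⟨c, fun ψ hψ => ?_⟩
  have := congrArg Subtype.val (LinearMap.congr_fun hc ⟨ψ, hψ⟩)
  simpa using this

end QLRC

namespace QLRC

open scoped Matrix ComplexOrder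

variable {n q : ℕ}

theorem sum_ite_agree (S : Finset (Fin n)) (y : Fin n → Fin q)
    (f : ({i // i ∈ S} → Fin q) → ℂ) :
    ∑ x : Fin n → Fin q, (if ∀ i ∉ S, x i = y i then f (fun i => x i) else 0) = ∑ b, f b := by
  rw [← Finset.sum_filter]
  refine Finset.sum_nbij' (fun x i => x i) (fun b i => if h : i ∈ S then b ⟨i, h⟩ else y i)
    (fun _ _ => Finset.mem_univ _) (fun b _ => ?_) (fun x hx => ?_) (fun b _ => ?_)
    (fun _ _ => rfl)
  · simp +contextual
  · ext i
    by_cases hi : i ∈ S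
    · simp [hi]
    · simp [hi, (Finset.mem_filter.1 hx).2 i hi]
  · ext i
    simp

theorem sum_extendKraus_conjTranspose_mul {j : Fin n} {S : Finset (Fin n)} (hj : j ∈ S)
    {κ : Type} [Fintype κ]
    (K : κ → Matrix ({i // i ∈ S} → Fin q) ({i // i ∈ S.erase j} → Fin q) ℂ)
    (hK : ∀ a a', ∑ m, ∑ b, star (K m b a) * K m b a' = if a = a' then 1 else 0)
    (a a' : Fin n → Fin q) :
    ∑ m, (extendKraus j S (K m) (a j))ᴴ * extendKraus j S (K m) (a' j) =
      matrixUnit {j} a a' := by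
  ext y y'
  rw [Matrix.sum_apply]
  simp only [Matrix.mul_apply, Matrix.conjTranspose_apply, matrixUnit, Matrix.of_apply,
    Finset.mem_singleton, forall_eq]
  by_cases h : (∀ i ∉ S, y i = y' i) ∧ y j = a j ∧ y' j = a' j
  · have h1 : ∀ m x, star (extendKraus j S (K m) (a j) x y) * extendKraus j S (K m) (a' j) x y' =
        if ∀ i ∉ S, x i = y i then
          star (K m (fun i => x i) (fun i => y i)) * K m (fun i => x i) (fun i => y' i) else 0 := by
      intro m x
      by_cases hx : ∀ i ∉ S, x i = y i
      · have hx' : ∀ i ∉ S, x i = y' i := fun i hi => (hx i hi).trans (h.1 i hi)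
        simp only [extendKraus, Matrix.of_apply]
        rw [if_pos ⟨hx, h.2.1⟩, if_pos ⟨hx', h.2.2⟩, if_pos hx]
      · simp only [extendKraus, Matrix.of_apply]
        rw [if_neg fun h => hx h.1, if_neg hx, star_zero, zero_mul]
    simp only [h1]
    rw [Finset.sum_congr rfl fun m _ => sum_ite_agree S y fun b =>
      star (K m b (fun i => y i)) * K m b (fun i => y' i), hK]
    refine if_congr ?_ rfl rfl
    constructor
    · intro h2
      refine ⟨h.2, fun i hi => ?_⟩
      by_cases hiS : i ∈ S
      · exact congrFun h2 ⟨i, Finset.mem_erase.2 ⟨hi, hiS⟩⟩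
      · exact h.1 i hiS
    · exact fun h2 => funext fun i => h2.2 i (Finset.mem_erase.1 i.2).1
  · rw [if_neg]
    · refine Finset.sum_eq_zero fun m _ => Finset.sum_eq_zero fun x _ => ?_
      simp only [extendKraus, Matrix.of_apply]
      by_cases h1 : (∀ i ∉ S, x i = y i) ∧ y j = a j
      · rw [if_neg (fun h2 : (∀ i ∉ S, x i = y' i) ∧ y' j = a' j => h
          ⟨fun i hi => (h1.1 i hi).symm.trans (h2.1 i hi), h1.2, h2.2⟩), mul_zero]
      · rw [if_neg h1, star_zero, zero_mul]
    · rintro ⟨h1, h2⟩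
      exact h ⟨fun i hi => h2 i fun hij => hi (hij ▸ hj), h1⟩

theorem matrixUnit_mul_extendKraus {A S : Finset (Fin n)} (hAS : Disjoint A S) {j : Fin n}
    (hj : j ∈ S)
    (K : Matrix ({i // i ∈ S} → Fin q) ({i // i ∈ S.erase j} → Fin q) ℂ) (c : Fin q)
    (a a' : Fin n → Fin q) :
    matrixUnit A a a' * extendKraus j S K c = extendKraus j S K c * matrixUnit A a a' := by
  have hA : ∀ i ∈ A, i ∉ S := fun _ h => Finset.disjoint_left.1 hAS h
  have hS : ∀ i ∈ S, i ∉ A := fun _ h => Finset.disjoint_right.1 hAS h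
  ext x z
  rw [Matrix.mul_apply, Matrix.mul_apply, Finset.sum_eq_single (S.piecewise x z),
    Finset.sum_eq_single (S.piecewise z x)]
  · have h1 : matrixUnit A a a' x (S.piecewise x z) = matrixUnit A a a' (S.piecewise z x) z := by
      simp only [matrixUnit, Matrix.of_apply]
      refine if_congr (and_congr (forall₂_congr fun i hi => ?_) (forall₂_congr fun i _ => ?_))
        rfl rfl
      · simp [hA i hi]
      · by_cases hi : i ∈ S <;> simp [hi]
    have h2 : extendKraus j S K c (S.piecewise x z) z = extendKraus j S K c x (S.piecewise z x) := by
      simp only [extendKraus, Matrix.of_apply]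
      have h3 : (fun i : {i // i ∈ S} => S.piecewise x z i) =
          fun i : {i // i ∈ S} => x i := by
        ext i; simp
      have h4 : (fun i : {i // i ∈ S.erase j} => S.piecewise z x i) =
          fun i : {i // i ∈ S.erase j} => z i := by
        ext i; simp [Finset.mem_of_mem_erase i.2]
      rw [h3, h4]
      refine if_congr (and_congr (forall₂_congr fun i hi => ?_) ?_) rfl rfl
      · simp [hi]
      · simp [hj]
    rw [h1, h2, mul_comm]
  · intro y _ hy
    by_contra hne
    obtain ⟨h1, h2⟩ := ne_zero_and_ne_zero_of_mul hne
    simp only [extendKraus, matrixUnit, Matrix.of_apply, ne_eq, ite_eq_right_iff, not_forall] at h1 h2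
    obtain ⟨⟨h1, -⟩, -⟩ := h1
    obtain ⟨⟨-, h2⟩, -⟩ := h2
    refine hy (funext fun i => ?_)
    by_cases hi : i ∈ S
    · simp [hi, h2 i (hS i hi)]
    · simp [hi, h1 i hi]
  · simp
  · intro y _ hy
    by_contra hne
    obtain ⟨h1, h2⟩ := ne_zero_and_ne_zero_of_mul hne
    simp only [extendKraus, matrixUnit, Matrix.of_apply, ne_eq, ite_eq_right_iff, not_forall] at h1 h2
    obtain ⟨⟨-, h1⟩, -⟩ := h1
    obtain ⟨⟨h2, -⟩, -⟩ := h2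
    refine hy (funext fun i => ?_)
    by_cases hi : i ∈ S
    · simp [hi, h1 i (hS i hi)]
    · simp [hi, h2 i hi]
  · simp

theorem matrixUnit_insert {A : Finset (Fin n)} {j : Fin n} (hj : j ∉ A) (a a' : Fin n → Fin q) :
    matrixUnit (insert j A) a a' = matrixUnit {j} a a' * matrixUnit A a a' := by
  refine Matrix.ext_of_mulVec_single fun z => ?_
  ext x
  rw [← Matrix.mulVec_mulVec, matrixUnit_mulVec, matrixUnit_mulVec, matrixUnit_mulVec]
  have h1 : (∀ i ∈ A, ({j} : Finset (Fin n)).piecewise a' x i = a i) ↔ ∀ i ∈ A, x i = a i :=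
    forall₂_congr fun i hi => by
      have : i ≠ j := fun h => hj (h ▸ hi)
      simp [this]
  have h2 : A.piecewise a' (({j} : Finset (Fin n)).piecewise a' x) =
      (insert j A).piecewise a' x := by
    ext i
    by_cases hi : i ∈ A <;> by_cases hij : i = j <;> simp [hi, hij, Finset.piecewise]
  simp only [h1, h2, Finset.forall_mem_insert, Finset.mem_singleton, forall_eq]
  split_ifs <;> first | rfl | tauto

/-- If qudit `j` can be recovered from a set disjoint from the correctable set `A`, then `A ∪ {j}`
is correctable. -/
theorem Correctable.insert_of_isRecoverySet {C : Code n q} {A S : Finset (Fin n)} {j : Fin n}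
    (hA : Correctable C A) (hS : IsRecoverySet C j S) (hj : j ∈ S) (hAS : Disjoint A S) :
    Correctable C (insert j A) := by
  obtain ⟨Φ, hΦ, hrec⟩ := hS
  obtain ⟨κ, _, K, hK, hK1⟩ := hΦ.exists_kraus
  have hscal : ∀ (m : κ) (c : Fin q), ∃ z : ℂ, ∀ ψ ∈ C, extendKraus j S (K m) c *ᵥ ψ = z • ψ :=
    fun m c => exists_mulVec_eq_smul C _ fun ψ hψ h1 => ⟨_, by
      have h2 := hrec ψ hψ h1
      rw [applyOn_partialTrace_proj hj K hK] at h2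
      exact eq_smul_of_sum_proj_eq
        (fun p : κ × Fin q => extendKraus j S (K p.1) p.2 *ᵥ ψ) h1 h2 (m, c)⟩
  choose z hz using hscal
  intro a a'
  obtain ⟨c, hc⟩ := hA a a'
  refine ⟨(∑ m, star (z m (a j)) * z m (a' j)) * c, fun φ hφ ψ hψ => ?_⟩
  rw [matrixUnit_insert (Finset.disjoint_right.1 hAS hj), ← sum_extendKraus_conjTranspose_mul hj K hK1,
    Finset.sum_mul, Matrix.sum_mulVec, dotProduct_sum, mul_assoc, Finset.sum_mul]
  refine Finset.sum_congr rfl fun m _ => ?_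
  rw [Matrix.mul_assoc, ← matrixUnit_mul_extendKraus hAS hj, ← Matrix.mulVec_mulVec,
    ← Matrix.mulVec_mulVec, Matrix.dotProduct_mulVec, ← Matrix.star_mulVec, hz m _ φ hφ, hz m _ ψ hψ,
    Matrix.mulVec_smul, star_smul, smul_dotProduct, dotProduct_smul, hc φ hφ ψ hψ]
  simp only [smul_eq_mul]
  ring

end QLRC

namespace QLRC

/-! ### Random orders and recovery sets -/

/-- The orders of `Fin n` in which `j` is a first element of `T`. -/
def ordersWithFirst {n : ℕ} (j : Fin n) (T : Finset (Fin n)) : Finset (Equiv.Perm (Fin n)) :=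
  Finset.univ.filter fun σ => ∀ i ∈ T, σ j ≤ σ i

theorem mem_ordersWithFirst {n : ℕ} {j : Fin n} {T : Finset (Fin n)} {σ : Equiv.Perm (Fin n)} :
    σ ∈ ordersWithFirst j T ↔ ∀ i ∈ T, σ j ≤ σ i := by
  simp [ordersWithFirst]

theorem card_ordersWithFirst_eq {n : ℕ} {i j : Fin n} {T : Finset (Fin n)} (hi : i ∈ T)
    (hj : j ∈ T) : (ordersWithFirst i T).card = (ordersWithFirst j T).card := by
  have hswap : ∀ k, Equiv.swap i j k ∈ T ↔ k ∈ T := by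
    intro k
    rcases eq_or_ne k i with rfl | h1
    · simp [hi, hj]
    rcases eq_or_ne k j with rfl | h2
    · simp [hi, hj]
    rw [Equiv.swap_apply_of_ne_of_ne h1 h2]
  refine Finset.card_equiv (Equiv.mulRight (Equiv.swap i j)) fun σ => ?_
  simp only [mem_ordersWithFirst, Equiv.coe_mulRight, Equiv.Perm.mul_apply, Equiv.swap_apply_right]
  constructor
  · exact fun h k hk => h _ ((hswap k).2 hk)
  · intro h k hk
    simpa using h _ ((hswap k).2 hk)

theorem card_ordersWithFirst_mul {n : ℕ} {j : Fin n} {T : Finset (Fin n)} (hj : j ∈ T) :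
    (ordersWithFirst j T).card * T.card = n.factorial := by
  have h1 : ∑ i ∈ T, (ordersWithFirst i T).card = n.factorial := by
    rw [← Finset.card_biUnion]
    · have : T.biUnion (fun i => ordersWithFirst i T) = Finset.univ := by
        ext σ
        obtain ⟨i, hi, hmin⟩ := T.exists_min_image σ ⟨j, hj⟩
        simp only [Finset.mem_biUnion, mem_ordersWithFirst, Finset.mem_univ, iff_true]
        exact ⟨i, hi, hmin⟩
      rw [this, Finset.card_univ, Fintype.card_perm, Fintype.card_fin]
    · intro i hi k hk hik
      rw [Function.onFun, Finset.disjoint_left]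
      intro σ h1 h2
      rw [mem_ordersWithFirst] at h1 h2
      exact hik (σ.injective (le_antisymm (h1 k hk) (h2 i hi)))
  rw [Finset.sum_congr rfl fun i hi => card_ordersWithFirst_eq hi hj, Finset.sum_const,
    smul_eq_mul, mul_comm] at h1
  exact h1

/-- The union of `L` sets of `r` elements, any two of which share `s` elements and any three of
which have no common element. -/
theorem card_biUnion_of_inter {X ι : Type} [DecidableEq X] [DecidableEq ι] {r s : ℕ}
    (F : ι → Finset X) (I : Finset ι) (h1 : ∀ l, (F l).card = r)
    (h2 : ∀ l₁ l₂, l₁ ≠ l₂ → (F l₁ ∩ F l₂).card = s)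
    (h3 : ∀ l₁ l₂ l₃, l₁ ≠ l₂ → l₁ ≠ l₃ → l₂ ≠ l₃ → F l₁ ∩ F l₂ ∩ F l₃ = ∅) :
    ((I.biUnion F).card : ℚ) = (2 * (r : ℚ) - ((I.card : ℚ) - 1) * s) / 2 * I.card := by
  induction I using Finset.induction_on with
  | empty => simp
  | insert m I hm ih =>
    have hint : (F m ∩ I.biUnion F).card = I.card * s := by
      rw [Finset.inter_biUnion, Finset.card_biUnion]
      · rw [Finset.sum_congr rfl fun l hl => h2 m l fun h => hm (h ▸ hl)]
        simp
      · intro a ha b hb hab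
        rw [Function.onFun, Finset.disjoint_iff_inter_eq_empty,
          ← Finset.inter_inter_distrib_left, ← Finset.inter_assoc]
        exact h3 m a b (fun h => hm (h ▸ ha)) (fun h => hm (h ▸ hb)) hab
    have hun := Finset.card_union_add_card_inter (F m) (I.biUnion F)
    rw [hint, h1, ← Finset.biUnion_insert] at hun
    have hun' : (((insert m I).biUnion F).card : ℚ) + I.card * s = r + (I.biUnion F).card := by
      exact_mod_cast hun
    rw [Finset.card_insert_of_notMem hm]
    push_cast
    rw [ih] at hun'
    linarith

/-- The conditions on the recovery sets of a single qudit. -/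
structure SunflowerLike {X : Type} [DecidableEq X] {t : ℕ} (r s : ℕ) (j : X)
    (F : Fin t → Finset X) : Prop where
  mem : ∀ l, j ∈ F l
  card_eq : ∀ l, (F l).card = r + 1
  card_inter : ∀ l₁ l₂, l₁ ≠ l₂ → (F l₁ ∩ F l₂).card = s + 1
  triple_inter : ∀ l₁ l₂ l₃, l₁ ≠ l₂ → l₁ ≠ l₃ → l₂ ≠ l₃ → F l₁ ∩ F l₂ ∩ F l₃ = {j}

theorem SunflowerLike.card_biUnion {X : Type} [DecidableEq X] {t r s : ℕ} {j : X}
    {F : Fin t → Finset X} (h : SunflowerLike r s j F) {I : Finset (Fin t)} (hI : I.Nonempty) :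
    ((I.biUnion F).card : ℚ) = Ne r I.card s := by
  have h0 := card_biUnion_of_inter (r := r) (s := s) (fun l => (F l).erase j) I
    (fun l => by rw [Finset.card_erase_of_mem (h.mem l), h.card_eq, Nat.add_sub_cancel])
    (fun l₁ l₂ hl => by
      rw [Finset.erase_inter, Finset.inter_erase, Finset.erase_idem,
        Finset.card_erase_of_mem (by simp [h.mem]), h.card_inter _ _ hl, Nat.add_sub_cancel])
    (fun l₁ l₂ l₃ h12 h13 h23 => by
      ext x
      have := Finset.ext_iff.1 (h.triple_inter _ _ _ h12 h13 h23) x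
      simp only [Finset.mem_inter, Finset.mem_singleton, Finset.mem_erase, Finset.notMem_empty]
        at this ⊢
      tauto)
  have h1 : I.biUnion F = insert j (I.biUnion fun l => (F l).erase j) := by
    ext x
    obtain ⟨l₀, hl₀⟩ := hI
    simp only [Finset.mem_biUnion, Finset.mem_insert, Finset.mem_erase]
    constructor
    · rintro ⟨l, hl, hx⟩
      by_cases hxj : x = j
      · exact Or.inl hxj
      · exact Or.inr ⟨l, hl, hxj, hx⟩
    · rintro (rfl | ⟨l, hl, -, hx⟩)
      · exact ⟨l₀, hl₀, h.mem _⟩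
      · exact ⟨l, hl, hx⟩
  rw [h1, Finset.card_insert_of_notMem (by simp), Nat.cast_add, h0, Ne, Nat.cast_one]

/-- In a random order, `j` comes first in one of its recovery sets with probability `p_e`. -/
theorem SunflowerLike.card_orders {n t r s : ℕ} {j : Fin n} {F : Fin t → Finset (Fin n)}
    (h : SunflowerLike r s j F) :
    ((Finset.univ.biUnion fun l => ordersWithFirst j (F l)).card : ℚ) =
      pe r t s * n.factorial := by
  have hinf : ∀ (I : Finset (Fin t)) (hI : I.Nonempty),
      I.inf' hI (fun l => ordersWithFirst j (F l)) = ordersWithFirst j (I.biUnion F) := by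
    intro I hI
    ext σ
    rw [Finset.mem_inf', mem_ordersWithFirst]
    simp only [mem_ordersWithFirst, Finset.mem_biUnion]
    exact ⟨fun h i ⟨l, hl, hi⟩ => h l hl i hi, fun h l hl i hi => h i ⟨l, hl, hi⟩⟩
  have hcard : ∀ I : Finset (Fin t), I.Nonempty →
      ((ordersWithFirst j (I.biUnion F)).card : ℚ) = n.factorial * (1 / Ne r I.card s) := by
    intro I hI
    obtain ⟨l, hl⟩ := hI
    have hj : j ∈ I.biUnion F := Finset.mem_biUnion.2 ⟨l, hl, h.mem l⟩
    have h1 := card_ordersWithFirst_mul hj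
    have h2 : 0 < (I.biUnion F).card := Finset.card_pos.2 ⟨j, hj⟩
    rw [← h.card_biUnion ⟨l, hl⟩, mul_one_div, eq_div_iff (by positivity)]
    exact_mod_cast h1
  have hie := congrArg (fun z : ℤ => (z : ℚ)) (Finset.inclusion_exclusion_card_biUnion
    (Finset.univ : Finset (Fin t)) fun l => ordersWithFirst j (F l))
  simp only [hinf, Int.cast_natCast, Int.cast_sum, Int.cast_mul, Int.cast_pow, Int.cast_neg,
    Int.cast_one] at hie
  rw [hie, Finset.sum_coe_sort (Finset.univ.powerset.filter fun I : Finset (Fin t) => I.Nonempty)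
    (fun I => (-1 : ℚ) ^ (I.card + 1) * ((ordersWithFirst j (I.biUnion F)).card : ℚ)),
    Finset.sum_filter]
  have h3 := Finset.sum_powerset_apply_card
    (fun L => if L = 0 then 0 else (-1 : ℚ) ^ (L + 1) * (n.factorial * (1 / Ne r L s)))
    (x := (Finset.univ : Finset (Fin t)))
  rw [pe, Finset.sum_mul]
  calc _ = ∑ I ∈ (Finset.univ : Finset (Fin t)).powerset, if I.card = 0 then 0 else
        (-1 : ℚ) ^ (I.card + 1) * (n.factorial * (1 / Ne r I.card s)) := by
        refine Finset.sum_congr rfl fun I _ => ?_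
        rcases I.eq_empty_or_nonempty with rfl | hI
        · simp
        · rw [if_pos hI, if_neg (Finset.card_ne_zero.2 hI), hcard I hI]
    _ = _ := h3
    _ = _ := by
        rw [Finset.card_univ, Fintype.card_fin, Finset.sum_range_succ']
        simp only [if_true, smul_zero, add_zero, Nat.succ_ne_zero, if_false, nsmul_eq_mul]
        rw [Finset.range_eq_Ico, show Finset.Icc 1 t = Finset.Ico (0 + 1) (t + 1) by
          ext; simp, ← Finset.sum_Ico_add' _ 0 t 1]
        refine Finset.sum_congr rfl fun x _ => ?_
        ring

/-- Some order puts many elements of `V` first in one of their recovery sets. -/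
theorem exists_order {n t r s : ℕ} {Γ : Fin t → Fin n → Finset (Fin n)}
    (h : ∀ j, SunflowerLike r s j fun l => Γ l j) (V : Finset (Fin n)) :
    ∃ σ : Equiv.Perm (Fin n),
      ⌈(V.card : ℚ) * pe r t s⌉₊ ≤ (V.filter fun j => ∃ l, ∀ i ∈ Γ l j, σ j ≤ σ i).card := by
  have hsum : ∑ σ : Equiv.Perm (Fin n),
      ((V.filter fun j => ∃ l, ∀ i ∈ Γ l j, σ j ≤ σ i).card : ℚ) =
      ∑ _σ : Equiv.Perm (Fin n), (V.card : ℚ) * pe r t s := by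
    simp only [Finset.card_filter, Nat.cast_sum]
    rw [Finset.sum_comm]
    have h1 : ∀ j, ∑ σ : Equiv.Perm (Fin n),
        (((if ∃ l, ∀ i ∈ Γ l j, σ j ≤ σ i then 1 else 0 : ℕ)) : ℚ) = pe r t s * n.factorial := by
      intro j
      rw [← (h j).card_orders, ← Nat.cast_sum, ← Finset.card_filter]
      congr 2
      ext σ
      simp [mem_ordersWithFirst]
    simp only [h1, Finset.sum_const, Finset.card_univ, Fintype.card_perm, Fintype.card_fin,
      nsmul_eq_mul]
    ring
  obtain ⟨σ, -, hσ⟩ := Finset.exists_le_of_sum_le Finset.univ_nonempty hsum.ge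
  exact ⟨σ, Nat.ceil_le.2 hσ⟩

end QLRC

namespace QLRC

/-! ### Averaging over subfamilies of a given size -/

/-- Counting of the members of a subfamily `T` that contain a given point, with a correction for
those that are chosen together with a distinguished one. -/
theorem indicator_add_card_le {ι : Type} [DecidableEq ι] (T J : Finset ι) {j₀ : ι} (hj₀ : j₀ ∈ J) :
    (if ∃ j ∈ J, j ∈ T then 1 else 0) + ((J.erase j₀).filter fun j => {j₀, j} ⊆ T).card ≤
      (J.filter fun j => {j} ⊆ T).card := by
  simp only [Finset.insert_subset_iff, Finset.singleton_subset_iff]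
  by_cases h0 : j₀ ∈ T
  · rw [if_pos ⟨j₀, hj₀, h0⟩]
    have h1 : J.filter (fun j => j ∈ T) =
        insert j₀ ((J.erase j₀).filter fun j => j₀ ∈ T ∧ j ∈ T) := by
      ext j
      simp only [Finset.mem_filter, Finset.mem_insert, Finset.mem_erase]
      by_cases hj : j = j₀
      · subst hj; simp [hj₀, h0]
      · simp [hj, h0]
    rw [h1, Finset.card_insert_of_notMem (by simp), add_comm]
  · simp only [h0, false_and, Finset.filter_false, Finset.card_empty, add_zero]
    split_ifs with h
    · obtain ⟨j, hj, hjT⟩ := h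
      exact Finset.card_pos.2 ⟨j, Finset.mem_filter.2 ⟨hj, hjT⟩⟩
    · exact Nat.zero_le _

/-- The subfamilies of size `N` whose union contains a point of multiplicity `|J'| > 0`. -/
theorem card_filter_exists_mem_add_le {ι : Type} [DecidableEq ι] {J J' : Finset ι} (hJ : J' ⊆ J)
    {N : ℕ} (hN : 2 ≤ N) :
    ((J.powersetCard N).filter fun T => ∃ j ∈ J', j ∈ T).card +
        (J'.card - 1) * (J.card - 2).choose (N - 2) ≤
      J'.card * (J.card - 1).choose (N - 1) := by
  rcases J'.eq_empty_or_nonempty with rfl | ⟨j₀, hj₀⟩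
  · simp
  have h := Finset.sum_le_sum fun T (_ : T ∈ J.powersetCard N) => indicator_add_card_le T J' hj₀
  rw [Finset.sum_add_distrib, ← Finset.card_filter] at h
  simp only [Finset.card_filter (fun j => (_ : Finset ι) ⊆ _)] at h
  rw [Finset.sum_comm, Finset.sum_comm (t := J')] at h
  simp only [← Finset.card_filter] at h
  rw [Finset.sum_congr rfl fun j hj => Finset.card_filter_powersetCard_subset {j₀, j} J N
      (by
        simp only [Finset.insert_subset_iff, Finset.singleton_subset_iff]
        exact ⟨hJ hj₀, hJ (Finset.mem_of_mem_erase hj)⟩)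
      ((Finset.card_le_two).trans hN),
    Finset.sum_congr rfl fun j (hj : j ∈ J') => Finset.card_filter_powersetCard_subset {j} J N
      (by simpa using hJ hj) (by simp; omega)] at h
  rw [Finset.sum_congr rfl fun j hj => by
    rw [Finset.card_pair (Finset.ne_of_mem_erase hj).symm]] at h
  simpa [Finset.card_erase_of_mem hj₀] using h

theorem exists_subfamily {n r M N : ℕ} (J V : Finset (Fin n)) (F : Fin n → Finset (Fin n))
    (hJ : J.card = M) (hF : ∀ j ∈ J, (F j).card = r + 1) (hV : ∀ j ∈ J, F j ⊆ V) (hN : N ≤ M) :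
    ∃ T ⊆ J, T.card = N ∧ ((T.biUnion F).card : ℚ) ≤ (N : ℚ) * (r + 1)
      - ((N : ℚ) * ((N : ℚ) - 1)) / ((M : ℚ) * ((M : ℚ) - 1)) * ((M : ℚ) * (r + 1) - V.card) := by
  rcases Nat.lt_or_ge N 2 with h2 | h2
  · obtain ⟨T, hT, hTN⟩ := Finset.exists_subset_card_eq (hN.trans hJ.ge)
    refine ⟨T, hT, hTN, ?_⟩
    have h0 : (N : ℚ) * ((N : ℚ) - 1) = 0 := by
      interval_cases N <;> simp
    rw [h0, zero_div, zero_mul, sub_zero]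
    have : (T.biUnion F).card ≤ T.card * (r + 1) :=
      Finset.card_biUnion_le_card_mul _ _ _ fun j hj => (hF j (hT hj)).le
    rw [hTN] at this
    exact_mod_cast this
  set P := (M - 1).choose (N - 1) with hP
  set Q := (M - 2).choose (N - 2) with hQ
  have hsum : ∑ T ∈ J.powersetCard N, (T.biUnion F).card + (M * (r + 1) - V.card) * Q ≤
      M * (r + 1) * P := by
    have h1 : ∀ T ∈ J.powersetCard N, (T.biUnion F).card =
        ∑ x ∈ V, if ∃ j ∈ J.filter (fun j => x ∈ F j), j ∈ T then 1 else 0 := by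
      intro T hT
      rw [Finset.mem_powersetCard] at hT
      rw [← Finset.card_filter]
      congr 1
      ext x
      simp only [Finset.mem_biUnion, Finset.mem_filter]
      constructor
      · rintro ⟨j, hj, hx⟩
        exact ⟨hV j (hT.1 hj) hx, j, ⟨hT.1 hj, hx⟩, hj⟩
      · rintro ⟨-, j, ⟨-, hx⟩, hj⟩
        exact ⟨j, hj, hx⟩
    rw [Finset.sum_congr rfl h1, Finset.sum_comm]
    simp only [← Finset.card_filter]
    have h3 : ∑ x ∈ V, (J.filter fun j => x ∈ F j).card = M * (r + 1) := by
      simp only [Finset.card_filter]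
      rw [Finset.sum_comm]
      simp only [← Finset.card_filter]
      rw [Finset.sum_congr rfl fun j hj => by
        rw [Finset.filter_mem_eq_inter, Finset.inter_eq_right.2 (hV j hj), hF j hj]]
      simp [hJ]
    have h4 : M * (r + 1) - V.card ≤ ∑ x ∈ V, ((J.filter fun j => x ∈ F j).card - 1) := by
      rw [Nat.sub_le_iff_le_add, ← h3, Finset.card_eq_sum_ones, ← Finset.sum_add_distrib]
      exact Finset.sum_le_sum fun x _ => le_tsub_add
    have h5 := Finset.sum_le_sum fun x (_ : x ∈ V) => card_filter_exists_mem_add_le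
      (Finset.filter_subset (fun j => x ∈ F j) J) h2
    rw [Finset.sum_add_distrib, ← Finset.sum_mul, ← Finset.sum_mul, h3, hJ] at h5
    refine (Nat.add_le_add_left (Nat.mul_le_mul_right _ h4) _).trans ?_
    convert! h5
  have hsumQ : ∑ T ∈ J.powersetCard N, ((T.biUnion F).card : ℚ) +
      ((M : ℚ) * (r + 1) - V.card) * Q ≤ (M : ℚ) * (r + 1) * P := by
    have h1 : (M : ℚ) * (r + 1) - V.card ≤ ((M * (r + 1) - V.card : ℕ) : ℚ) := by
      have := le_tsub_add (a := V.card) (b := M * (r + 1))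
      rw [sub_le_iff_le_add]
      exact_mod_cast this
    have h2 : ∑ T ∈ J.powersetCard N, ((T.biUnion F).card : ℚ) +
      ((M * (r + 1) - V.card : ℕ) : ℚ) * Q ≤ (M : ℚ) * (r + 1) * P := by exact_mod_cast hsum
    have h3 := mul_le_mul_of_nonneg_right h1 (Nat.cast_nonneg (α := ℚ) Q)
    linarith
  have hMP : (M : ℚ) * P = N * M.choose N := by
    obtain ⟨m, rfl⟩ : ∃ m, M = m + 1 := ⟨M - 1, by omega⟩
    obtain ⟨k, rfl⟩ : ∃ k, N = k + 1 := ⟨N - 1, by omega⟩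
    have := Nat.add_one_mul_choose_eq m k
    simp only [Nat.add_sub_cancel] at hP
    rw [hP, mul_comm ((k + 1 : ℕ) : ℚ)]
    exact_mod_cast this
  have hMQ : ((M : ℚ) - 1) * Q = ((N : ℚ) - 1) * P := by
    obtain ⟨m, rfl⟩ : ∃ m, M = m + 2 := ⟨M - 2, by omega⟩
    obtain ⟨k, rfl⟩ : ∃ k, N = k + 2 := ⟨N - 2, by omega⟩
    have := Nat.add_one_mul_choose_eq m k
    simp only [Nat.add_sub_cancel, Nat.add_succ_sub_one] at hP hQ
    have h' : ((m + 1 : ℕ) : ℚ) * m.choose k = (m + 1).choose (k + 1) * ((k + 1 : ℕ) : ℚ) := by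
      exact_mod_cast this
    rw [hP, hQ]
    push_cast at h' ⊢
    linarith
  have hM2 : (2 : ℚ) ≤ M := by exact_mod_cast h2.trans hN
  obtain ⟨T, hT, hTle⟩ := Finset.exists_le_of_sum_le
    (s := J.powersetCard N) (f := fun T => ((T.biUnion F).card : ℚ))
    (g := fun _ => (N : ℚ) * (r + 1)
      - ((N : ℚ) * ((N : ℚ) - 1)) / ((M : ℚ) * ((M : ℚ) - 1)) * ((M : ℚ) * (r + 1) - V.card))
    (Finset.powersetCard_nonempty.2 (hN.trans hJ.ge)) (by
      rw [Finset.sum_const, Finset.card_powersetCard, hJ, nsmul_eq_mul]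
      have hMM : (M : ℚ) * ((M : ℚ) - 1) ≠ 0 := by
        have : (0 : ℚ) < (M : ℚ) * ((M : ℚ) - 1) := mul_pos (by linarith) (by linarith)
        exact this.ne'
      have hQ' : (M.choose N : ℚ) * (((N : ℚ) * ((N : ℚ) - 1)) / ((M : ℚ) * ((M : ℚ) - 1))) = Q := by
        rw [mul_div_assoc', div_eq_iff hMM]
        linear_combination (-(M : ℚ)) * hMQ - ((N : ℚ) - 1) * hMP
      rw [mul_sub, ← mul_assoc _ _ ((M : ℚ) * (r + 1) - V.card), hQ']
      linear_combination hsumQ + ((r : ℚ) + 1) * hMP)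
  rw [Finset.mem_powersetCard] at hT
  exact ⟨T, hT.1, hT.2, hTle⟩

end QLRC

namespace QLRC

variable {n q : ℕ}

/-! ### The bound on the dimension -/

/-- Qudits that come first in one of their recovery sets can be recovered one after the other. -/
theorem Correctable.union_of_order {C : Code n q} {B : Finset (Fin n)} (hB : Correctable C B)
    (σ : Equiv.Perm (Fin n)) (S : Fin n → Finset (Fin n)) (T : Finset (Fin n))
    (hS : ∀ j ∈ T, IsRecoverySet C j (S j)) (hmem : ∀ j ∈ T, j ∈ S j)
    (hfirst : ∀ j ∈ T, ∀ i ∈ S j, σ j ≤ σ i) (hBS : ∀ j ∈ T, Disjoint B (S j)) :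
    Correctable C (T ∪ B) := by
  induction T using Finset.induction_on_max_value σ with
  | empty => simpa using hB
  | insert a T ha hmax ih =>
    have hsub : ∀ j ∈ T, j ∈ insert a T := fun j => Finset.mem_insert_of_mem
    have haT : a ∈ insert a T := Finset.mem_insert_self a T
    rw [Finset.insert_union]
    refine (ih (fun j hj => hS j (hsub j hj)) (fun j hj => hmem j (hsub j hj))
      (fun j hj => hfirst j (hsub j hj)) (fun j hj => hBS j (hsub j hj))).insert_of_isRecoverySet
      (hS a haT) (hmem a haT) ?_
    rw [Finset.disjoint_union_left]
    refine ⟨Finset.disjoint_left.2 fun x hx hxa => ha ?_, hBS a haT⟩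
    rwa [σ.injective (le_antisymm (hfirst a haT x hxa) (hmax x hx))]

theorem ExactCondition.sunflowerLike {t r s : ℕ} {Γ : Fin t → Fin n → Finset (Fin n)}
    (h : ExactCondition r s Γ) (j : Fin n) : SunflowerLike r s j fun l => Γ l j where
  mem l := h.mem l j
  card_eq l := h.card_eq l j
  card_inter := h.card_inter j
  triple_inter := h.triple_inter j

/-- The set whose supremum defines `N₁`. -/
theorem N₁_mem {m r d M : ℕ} (hd : 1 ≤ d) (hm : max (r + 1) (d - 1) ≤ m) :
    N₁ m r d M ≤ M ∧
      (N₁ m r d M : ℚ) * (r + 1)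
          - ((N₁ m r d M : ℚ) * ((N₁ m r d M : ℚ) - 1)) / ((M : ℚ) * ((M : ℚ) - 1))
            * ((M : ℚ) * (r + 1) - m)
        ≤ (m : ℚ) - ((d : ℚ) - 1) := by
  rw [N₁, if_pos hm]
  refine Nat.sSup_mem (s := {N : ℕ | N ≤ M ∧
      (N : ℚ) * (r + 1)
          - ((N : ℚ) * ((N : ℚ) - 1)) / ((M : ℚ) * ((M : ℚ) - 1)) * ((M : ℚ) * (r + 1) - m)
        ≤ (m : ℚ) - ((d : ℚ) - 1)}) ⟨0, Nat.zero_le _, ?_⟩ ⟨M, fun N hN => hN.1⟩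
  have : d ≤ m + 1 := by omega
  have : (d : ℚ) ≤ m + 1 := by exact_mod_cast this
  simp
  linarith

theorem exists_correctable {C : Code n q} {d t r s : ℕ} (hd : 1 ≤ d) (ht : 1 ≤ t)
    (hC : DistanceAtLeast C d) {Γ : Fin t → Fin n → Finset (Fin n)} (hΓ : ExactCondition r s Γ)
    (hrec : ∀ l j, IsRecoverySet C j (Γ l j)) (V : Finset (Fin n)) (hV : d - 1 ≤ V.card) :
    ∃ A ⊆ V, Correctable C A ∧
      A.card = (d - 1) + N₁ V.card r d ⌈(V.card : ℚ) * pe r t s⌉₊ := by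
  by_cases hm : max (r + 1) (d - 1) ≤ V.card
  swap
  · obtain ⟨A, hA, hAc⟩ := Finset.exists_subset_card_eq hV
    refine ⟨A, hA, hC.correctable (by omega), ?_⟩
    rw [N₁, if_neg hm, hAc, add_zero]
  obtain ⟨hNM, hN⟩ := N₁_mem (M := ⌈(V.card : ℚ) * pe r t s⌉₊) hd hm
  generalize hMdef : ⌈(V.card : ℚ) * pe r t s⌉₊ = M at hNM hN ⊢
  generalize N₁ V.card r d M = N at hNM hN ⊢
  obtain ⟨σ, hσ⟩ := exists_order hΓ.sunflowerLike V
  rw [hMdef] at hσ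
  obtain ⟨J, hJ, hJM⟩ := Finset.exists_subset_card_eq hσ
  have hJV : ∀ j ∈ J, j ∈ V := fun j hj => (Finset.mem_filter.1 (hJ hj)).1
  have hl : ∀ j, ∃ S : Finset (Fin n), IsRecoverySet C j S ∧ j ∈ S ∧ S.card = r + 1 ∧
      (j ∈ J → ∀ i ∈ S, σ j ≤ σ i) := by
    intro j
    by_cases hj : j ∈ J
    · obtain ⟨l, hl⟩ := (Finset.mem_filter.1 (hJ hj)).2
      exact ⟨Γ l j, hrec l j, hΓ.mem l j, hΓ.card_eq l j, fun _ => hl⟩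
    · exact ⟨Γ ⟨0, ht⟩ j, hrec _ j, hΓ.mem _ j, hΓ.card_eq _ j, fun h => absurd h hj⟩
  choose S hSrec hSmem hScard hSfirst using hl
  have hF : ∀ j, ∃ F : Finset (Fin n), S j ∩ V ⊆ F ∧ F ⊆ V ∧ F.card = r + 1 := fun j =>
    Finset.exists_subsuperset_card_eq Finset.inter_subset_right
      ((Finset.card_le_card Finset.inter_subset_left).trans (hScard j).le)
      ((le_max_left _ _).trans hm)
  choose F hSF hFV hFcard using hF
  obtain ⟨T, hTJ, hTN, hT⟩ := exists_subfamily J V F hJM (fun j _ => hFcard j)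
    (fun j _ => hFV j) hNM
  have hU : (T.biUnion F).card + (d - 1) ≤ V.card := by
    have h1 := hT.trans hN
    have h2 : (T.biUnion F).card + d ≤ V.card + 1 := by
      have : ((T.biUnion F).card : ℚ) + d ≤ V.card + 1 := by linarith
      exact_mod_cast this
    omega
  obtain ⟨B, hB, hBc⟩ := Finset.exists_subset_card_eq (s := V \ T.biUnion F) (n := d - 1) (by
    have := Finset.le_card_sdiff (T.biUnion F) V
    omega)
  have hBF : ∀ j ∈ T, ∀ x ∈ B, x ∉ S j := fun j hj x hx hxS =>
    (Finset.mem_sdiff.1 (hB hx)).2 (Finset.mem_biUnion.2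
      ⟨j, hj, hSF j (Finset.mem_inter.2 ⟨hxS, (Finset.mem_sdiff.1 (hB hx)).1⟩)⟩)
  refine ⟨T ∪ B, Finset.union_subset (fun j hj => hJV j (hTJ hj))
    (hB.trans Finset.sdiff_subset), (hC.correctable (by omega)).union_of_order σ S T
    (fun j _ => hSrec j) (fun j _ => hSmem j) (fun j hj => hSfirst j (hTJ hj))
    (fun j hj => Finset.disjoint_left.2 (hBF j hj)), ?_⟩
  rw [Finset.card_union_of_disjoint (Finset.disjoint_right.2 fun x hx hxT =>
    hBF x hxT x hx (hSmem x)), hTN, hBc, add_comm]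

/-- The bound on the number of logical qudits. -/
theorem bound_of_isExactQLRC {d t r s k : ℕ} {C : Code n q} (hd : 1 ≤ d) (ht : 1 ≤ t) (hq : 2 ≤ q)
    (hC : HasParameters C k d) (hL : IsExactQLRC C r t s) :
    (k : ℤ) ≤ max 0 ((n : ℤ) - M₁ n d r t s - M₂ n d r t s) := by
  obtain ⟨hk, hdist⟩ := hC
  obtain ⟨Γ, hΓ, hrec⟩ := hL
  have : NeZero q := ⟨by omega⟩
  have key : ∀ A B : Finset (Fin n), Correctable C A → Correctable C B → Disjoint A B →
      k ≤ n - A.card - B.card := by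
    intro A B hA hB hAB
    have := hA.finrank_le hB hAB
    rw [hk] at this
    exact (Nat.pow_le_pow_iff_right (by omega)).1 this
  by_cases hn : d - 1 ≤ n
  swap
  · have := key Finset.univ ∅ (hdist.correctable (by simp; omega))
      (hdist.correctable (by simp; omega)) (Finset.disjoint_empty_right _)
    simp at this
    simp [this]
  obtain ⟨A, -, hA, hAc⟩ := exists_correctable hd ht hdist hΓ hrec Finset.univ (by simpa using hn)
  rw [Finset.card_univ, Fintype.card_fin] at hAc
  have hM₁ : A.card = M₁ n d r t s := hAc
  have hcompl : Aᶜ.card = n - M₁ n d r t s := by rw [Finset.card_compl, hM₁, Fintype.card_fin]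
  have hle : M₁ n d r t s ≤ n := by
    rw [← hM₁]
    simpa using Finset.card_le_univ A
  by_cases hm : d - 1 ≤ Aᶜ.card
  swap
  · have := key A Aᶜ hA (hdist.correctable (by omega)) disjoint_compl_right
    rw [hM₁, hcompl, Nat.sub_self] at this
    rw [Nat.le_zero.1 this]
    simp
  obtain ⟨B, hBA, hB, hBc⟩ := exists_correctable hd ht hdist hΓ hrec Aᶜ hm
  rw [hcompl] at hBc
  have hM₂ : B.card = M₂ n d r t s := hBc
  have hBle := Finset.card_le_card hBA
  have := key A B hA hB (Finset.disjoint_left.2 fun x hx hxB => Finset.mem_compl.1 (hBA hxB) hx)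
  rw [hM₁, hM₂] at this
  refine le_max_of_le_right ?_
  omega

end QLRC

namespace QLRC

/-! ### Comparison with the Golowich–Guruswami bound -/

theorem SunflowerLike.one_div_le_pe {n t r s : ℕ} {j : Fin n} {F : Fin t → Finset (Fin n)}
    (h : SunflowerLike r s j F) (ht : 1 ≤ t) : 1 / ((r : ℚ) + 1) ≤ pe r t s := by
  have h1 := card_ordersWithFirst_mul (h.mem ⟨0, ht⟩)
  rw [h.card_eq] at h1
  have h2 := Finset.card_le_card (Finset.subset_biUnion_of_mem
    (fun l => ordersWithFirst j (F l)) (Finset.mem_univ (⟨0, ht⟩ : Fin t)))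
  have h3 : ((ordersWithFirst j (F ⟨0, ht⟩)).card : ℚ) ≤ pe r t s * n.factorial := by
    rw [← h.card_orders]
    exact_mod_cast h2
  have h4 : ((ordersWithFirst j (F ⟨0, ht⟩)).card : ℚ) * (r + 1) = n.factorial := by
    exact_mod_cast h1
  have h5 : (0 : ℚ) < n.factorial := by exact_mod_cast n.factorial_pos
  rw [div_le_iff₀ (by positivity)]
  rw [← h4, ← mul_assoc] at h3
  have h6 : (0 : ℚ) < (ordersWithFirst j (F ⟨0, ht⟩)).card := by
    by_contra! h6
    have : (0 : ℚ) ≤ (r : ℚ) + 1 := by positivity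
    nlinarith
  nlinarith

/-- The shared points of the `l`-th set: `s` points for each pair of sets. -/
def sharedPoints {t : ℕ} (s : ℕ) (l : Fin t) : Finset (Sym2 (Fin t) × Fin s) :=
  Finset.univ.filter fun p => l ∈ p.1 ∧ ¬ p.1.IsDiag

theorem card_sharedPoints {t s : ℕ} (l : Fin t) : (sharedPoints s l).card = s * (t - 1) := by
  have h : sharedPoints s l = ((Finset.univ.erase l).image fun l' => s(l, l')) ×ˢ Finset.univ := by
    ext ⟨e, u⟩
    simp only [sharedPoints, Finset.mem_filter, Finset.mem_univ, true_and, Finset.mem_product,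
      Finset.mem_image, Finset.mem_erase, and_true]
    constructor
    · rintro ⟨⟨l', rfl⟩, hd⟩
      exact ⟨l', fun h => hd (by simp [h]), rfl⟩
    · rintro ⟨l', hl', rfl⟩
      exact ⟨Sym2.mem_mk_left _ _, by simpa using hl'.symm⟩
  rw [h, Finset.card_product, Finset.card_image_of_injective _ fun a b hab =>
    Sym2.congr_right.1 hab, Finset.card_erase_of_mem (Finset.mem_univ _)]
  simp [mul_comm]

/-- A family of `t` sets: a common point, the shared points and `r - s (t - 1)` private points for
each set. -/
def modelSets {t : ℕ} (r s : ℕ) (l : Fin t) :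
    Finset (Option ((Sym2 (Fin t) × Fin s) ⊕ (Fin t × Fin (r - s * (t - 1))))) :=
  Finset.insertNone ((sharedPoints s l).disjSum ({l} ×ˢ Finset.univ))

theorem sunflowerLike_modelSets {t r s : ℕ} (h : s * (t - 1) ≤ r) :
    SunflowerLike r s none (modelSets (t := t) r s) := by
  have hnone : ∀ l : Fin t, none ∈ modelSets r s l := fun l => Finset.none_mem_insertNone
  have hinl : ∀ (l : Fin t) e u, some (Sum.inl (e, u)) ∈ modelSets r s l ↔
      l ∈ e ∧ ¬ e.IsDiag := fun l e u => by simp [modelSets, sharedPoints]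
  have hinr : ∀ (l l' : Fin t) u, some (Sum.inr (l', u)) ∈ modelSets r s l ↔ l' = l :=
    fun l l' u => by simp [modelSets, eq_comm]
  refine ⟨hnone, fun l => ?_, fun l₁ l₂ h12 => ?_, fun l₁ l₂ l₃ h12 h13 h23 => ?_⟩
  · simp only [modelSets, Finset.card_insertNone, Finset.card_disjSum, card_sharedPoints,
      Finset.card_product, Finset.card_singleton, Finset.card_univ, Fintype.card_fin]
    omega
  · have : modelSets r s l₁ ∩ modelSets r s l₂ = Finset.insertNone
        (({s(l₁, l₂)} ×ˢ (Finset.univ : Finset (Fin s))).disjSum ∅) := by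
      ext x
      rcases x with _ | ⟨e, u⟩ | ⟨l, u⟩
      · simp [hnone]
      · rw [Finset.mem_inter, hinl, hinl]
        simp only [Finset.some_mem_insertNone, Finset.inl_mem_disjSum, Finset.mem_univ,
          Finset.mem_product, Finset.mem_singleton, and_true]
        constructor
        · rintro ⟨h1, h2⟩
          exact (Sym2.mem_and_mem_iff h12).1 ⟨h1.1, h2.1⟩
        · rintro rfl
          simp [h12]
      · rw [Finset.mem_inter, hinr, hinr]
        simp only [Finset.some_mem_insertNone, Finset.inr_mem_disjSum, Finset.notMem_empty,
          iff_false]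
        exact fun h => h12 (h.1.symm.trans h.2)
    rw [this]
    simp
  · ext x
    rcases x with _ | ⟨e, u⟩ | ⟨l, u⟩
    · simp [hnone]
    · rw [Finset.mem_inter, Finset.mem_inter, hinl, hinl, hinl]
      simp only [Finset.mem_singleton, reduceCtorEq, iff_false]
      rintro ⟨⟨h1, h2⟩, h3⟩
      rw [(Sym2.mem_and_mem_iff h12).1 ⟨h1.1, h2.1⟩, Sym2.mem_iff] at h3
      rcases h3.1 with h3 | h3
      · exact h13 h3.symm
      · exact h23 h3.symm
    · rw [Finset.mem_inter, Finset.mem_inter, hinr, hinr]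
      simp only [Finset.mem_singleton, reduceCtorEq, iff_false]
      exact fun h => h12 (h.1.1.symm.trans h.1.2)

theorem exists_sunflowerLike {t r s : ℕ} (h : s * (t - 1) ≤ r) :
    ∃ (n : ℕ) (j : Fin n) (F : Fin t → Finset (Fin n)), SunflowerLike r s j F := by
  have hG := sunflowerLike_modelSets h
  let e := Fintype.equivFin (Option ((Sym2 (Fin t) × Fin s) ⊕ (Fin t × Fin (r - s * (t - 1)))))
  refine ⟨_, e none, fun l => (modelSets r s l).map e.toEmbedding, fun l => ?_, fun l => ?_,
    fun l₁ l₂ h12 => ?_, fun l₁ l₂ l₃ h12 h13 h23 => ?_⟩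
  · exact Finset.mem_map_of_mem e.toEmbedding (hG.mem l)
  · rw [Finset.card_map, hG.card_eq]
  · rw [← Finset.map_inter, Finset.card_map, hG.card_inter _ _ h12]
  · rw [← Finset.map_inter, ← Finset.map_inter, hG.triple_inter _ _ _ h12 h13 h23,
      Finset.map_singleton]
    rfl

theorem one_div_le_pe {t r s : ℕ} (ht : 1 ≤ t) (h : s * (t - 1) ≤ r) :
    1 / ((r : ℚ) + 1) ≤ pe r t s := by
  obtain ⟨n, j, F, hF⟩ := exists_sunflowerLike h
  exact hF.one_div_le_pe ht

theorem floor_le_N₁ {m d r t s : ℕ} (hd : 1 ≤ d) (ht : 1 ≤ t) (h : s * (t - 1) ≤ r) :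
    ⌊((m : ℚ) - ((d : ℚ) - 1)) / ((r : ℚ) + 1)⌋ ≤ (N₁ m r d ⌈(m : ℚ) * pe r t s⌉₊ : ℤ) := by
  rcases le_or_gt ⌊((m : ℚ) - ((d : ℚ) - 1)) / ((r : ℚ) + 1)⌋ 0 with h0 | h0
  · exact h0.trans (Int.natCast_nonneg _)
  have hr : (0 : ℚ) < (r : ℚ) + 1 := by positivity
  have hfl := Int.floor_le (((m : ℚ) - ((d : ℚ) - 1)) / ((r : ℚ) + 1))
  obtain ⟨N, hN⟩ := Int.eq_ofNat_of_zero_le h0.le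
  rw [hN] at h0 hfl ⊢
  rw [le_div_iff₀ hr, Int.cast_natCast] at hfl
  have hN1 : (1 : ℚ) ≤ N := by exact_mod_cast h0
  have hd' : (1 : ℚ) ≤ d := by exact_mod_cast hd
  have hmr : (r : ℚ) + d ≤ m := by nlinarith
  have hmr' : r + d ≤ m := by exact_mod_cast hmr
  set M := ⌈(m : ℚ) * pe r t s⌉₊ with hM
  have hmM : (m : ℚ) ≤ M * (r + 1) := by
    have h1 := Nat.le_ceil ((m : ℚ) * pe r t s)
    have h2 := mul_le_mul_of_nonneg_left (one_div_le_pe ht h) (Nat.cast_nonneg (α := ℚ) m)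
    rw [mul_one_div] at h2
    exact (div_le_iff₀ hr).1 (h2.trans h1)
  have hNM : N ≤ M := by
    have : (N : ℚ) ≤ M := le_of_mul_le_mul_right (by linarith) hr
    exact_mod_cast this
  have hM1 : (1 : ℚ) ≤ M := hN1.trans (by exact_mod_cast hNM)
  rw [N₁, if_pos (by omega)]
  refine Int.ofNat_le.2 (le_csSup ⟨M, fun _ h => h.1⟩ ⟨hNM, ?_⟩)
  have h1 : (0 : ℚ) ≤ ((N : ℚ) * ((N : ℚ) - 1)) / ((M : ℚ) * ((M : ℚ) - 1)) *
      ((M : ℚ) * (r + 1) - m) :=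
    mul_nonneg (div_nonneg (mul_nonneg (by linarith) (by linarith))
      (mul_nonneg (by linarith) (by linarith))) (by linarith)
  linarith

theorem le_ggBound {n d r t s : ℕ} (hd : 1 ≤ d) (ht : 1 ≤ t) (h : s * (t - 1) ≤ r) :
    (n : ℤ) - M₁ n d r t s - M₂ n d r t s ≤ ggBound n d r := by
  have h1 := floor_le_N₁ (m := n) hd ht h
  have h2 := floor_le_N₁ (m := n - M₁ n d r t s) hd ht h
  have hM₁ : (M₁ n d r t s : ℤ) = ((d : ℤ) - 1) + N₁ n r d ⌈(n : ℚ) * pe r t s⌉₊ := by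
    rw [M₁]
    omega
  have hM₂ : (M₂ n d r t s : ℤ) = ((d : ℤ) - 1) +
      N₁ (n - M₁ n d r t s) r d ⌈((n - M₁ n d r t s : ℕ) : ℚ) * pe r t s⌉₊ := by
    rw [M₂]
    omega
  have hsub : (n : ℚ) - M₁ n d r t s ≤ ((n - M₁ n d r t s : ℕ) : ℚ) := by
    rw [sub_le_iff_le_add]
    exact_mod_cast le_tsub_add
  rw [ggBound, hM₂, hM₁]
  have hM₁Q : (M₁ n d r t s : ℚ) = ((d : ℚ) - 1) + (N₁ n r d ⌈(n : ℚ) * pe r t s⌉₊ : ℤ) := by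
    exact_mod_cast congrArg (fun z : ℤ => (z : ℚ)) hM₁
  generalize ((N₁ n r d ⌈(n : ℚ) * pe r t s⌉₊ : ℕ) : ℤ) = a at *
  generalize (N₁ (n - M₁ n d r t s) r d ⌈((n - M₁ n d r t s : ℕ) : ℚ) * pe r t s⌉₊ : ℤ) = b at *
  generalize ⌊((n : ℚ) - ((d : ℚ) - 1)) / ((r : ℚ) + 1)⌋ = f at *
  have hr : (0 : ℚ) < (r : ℚ) + 1 := by positivity
  have h3 := Int.floor_le (((n : ℚ) - 2 * ((d : ℚ) - 1) - (f : ℤ)) / ((r : ℚ) + 1))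
  generalize ⌊((n : ℚ) - 2 * ((d : ℚ) - 1) - (f : ℤ)) / ((r : ℚ) + 1)⌋ = g at *
  rw [le_div_iff₀ hr] at h3
  have h4 : g - (a - f) ≤ ⌊(((n - M₁ n d r t s : ℕ) : ℚ) - ((d : ℚ) - 1)) / ((r : ℚ) + 1)⌋ := by
    rw [Int.le_floor, le_div_iff₀ hr]
    push_cast
    have h5 : (f : ℚ) ≤ a := by exact_mod_cast h1
    have h6 : (0 : ℚ) ≤ ((a : ℚ) - f) * r := mul_nonneg (by linarith) (Nat.cast_nonneg _)
    linarith
  omega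

end QLRC

theorem mainTheorem3 (n d r t s : ℕ) (hn : 1 ≤ n) (hd : 1 ≤ d) (hr : 1 ≤ r) (ht : 1 ≤ t) :
    (∀ (q k : ℕ) (C : QLRC.Code n q), 2 ≤ q → 1 ≤ k →
      QLRC.HasParameters C k d → QLRC.IsExactQLRC C r t s →
        (k : ℤ) ≤ max 0 ((n : ℤ) - QLRC.M₁ n d r t s - QLRC.M₂ n d r t s)) ∧
    (s * (t - 1) ≤ r →
      (n : ℤ) - QLRC.M₁ n d r t s - QLRC.M₂ n d r t s ≤ QLRC.ggBound n d r) :=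
  ⟨fun _ _ _ hq _ hC hL => QLRC.bound_of_isExactQLRC hd ht hq hC hL,
    fun h => QLRC.le_ggBound hd ht h⟩
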